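/- **Theorem.** Let $\mathbb K$ be a field of characteristic zero. *Preordered forests.* A preordered forest is a finite rooted forest $F$ (edges oriented towards the roots; $v\twoheadrightarrow w$ means that there is an oriented path, possibly of length $0$, from $v$ to $w$) together with a total preorder $\le$ on its set of vertices $V(F)$; forests are taken up to isomorphism. Let $\sigma\colon V(F)\to\{1,\dots,q\}$ be the unique surjection such that $v\le w\iff\sigma(v)\le\sigma(w)$. $F$ is heap-preordered if $\sigma(a)>\sigma(b)$ whenever $a\ne b$ and $a\twoheadrightarrow b$. Let $\mathbf H_{po}$ be the $\mathbb K$-vector space with basis the preordered forests, graded by the number of vertices. The product $FG$ is the disjoint union in which the preorders of $F$ and $G$ are kept and every vertex of $F$ is strictly smaller than every vertex of $G$. The coproduct is $\Delta(F)=\sum_{\boldsymbol v} Lea_{\boldsymbol v}(F)\otimes Roo_{\boldsymbol v}(F)$, the sum being over all admissible cuts, that is, all $\boldsymbol v\subseteq V(F)$ no two different elements of which are related by $\twoheadrightarrow$ (including the empty set); $Lea_{\boldsymbol v}(F)$ is the induced preordered subforest on $\{w : \exists v\in\boldsymbol v,\ w\twoheadrightarrow v\}$, and $Roo_{\boldsymbol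 v}(F)$ the one on the complement. The unit is the empty forest and the counit is the coefficient of the empty forest. $\mathbf H_{hpo}\subseteq\mathbf H_{po}$ is the subspace spanned by the heap-preordered forests, with the restricted operations. *Packed words.* A packed word of length $n$ is a word $\tau=\tau(1)\cdots\tau(n)$ whose set of letters is $\{1,\dots,k\}$ for some $k\ge 0$; put $\max\tau=k$. $\mathbf{WQSym}^*$ is the $\mathbb K$-vector space with basis the packed words, graded by length. The product of $\sigma$ and $\tau$ is the sum, with multiplicity, of all shufflings of $\sigma$ with the word obtained from $\tau$ by adding $\max\sigma$ to all its letters; the coproduct of $\tau$ is $\sum_{k=0}^{n} pack(\tau(1)\cdots\tau(k))\otimes pack(\tau(k+1)\cdots\tau(n))$, where $pack$ replaces the $i$-th smallest letter of a word by $i$. The unit is the empty word and the counit is the coefficient of the empty word. *The map.* Let $\Phi\colon\mathbf H_{po}\to\mathbf{WQSym}^*$ be the linear map $$\Phi(F)=\sum_{\tau}\operatorname{card}\bigl(\mathbb S_F^{\tau}\bigr)\,\tau ,$$ the sum being over the packed words $\tau$ of length $n=|V(F)|$, where $\mathbb S_F^\tau$ is the set of bijections $\varphi\colon V(F)\to\{1,\dots,n\}$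 such that $\sigma(v)=\tau(\varphi(v))$ for all $v\in V(F)$, and $\varphi(v)\ge\varphi(v')$ whenever $v'\twoheadrightarrow v$. Then $\mathbf H_{hpo}$ and $\mathbf{WQSym}^*$ are graded Hopf algebras, and the restriction of $\Phi$ to $\mathbf H_{hpo}$ is an injective morphism of graded Hopf algebras $\mathbf H_{hpo}\to\mathbf{WQSym}^*$. -/

import Mathlib

open scoped TensorProduct

/-! ## Hopf algebras given by explicit structure maps -/

/-- Candidate structure maps of a Hopf algebra on the vector space `A`. -/
structure StructureMaps (K A : Type*) [Field K] [AddCommGroup A] [Module K A] where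
  mul : A →ₗ[K] A →ₗ[K] A
  one : A
  comul : A →ₗ[K] A ⊗[K] A
  counit : A →ₗ[K] K

namespace StructureMaps

variable {K A : Type*} [Field K] [AddCommGroup A] [Module K A]

/-- The structure maps make `A` a Hopf algebra: an associative unital algebra, a coassociative
counital coalgebra, the coproduct and the counit are algebra morphisms, and there is an antipode.
`TensorProduct.map₂ m.mul m.mul` is the product `(a ⊗ b) (c ⊗ d) = a c ⊗ b d` of `A ⊗ A`. -/
structure IsHopf (m : StructureMaps K A) : Prop where
  mul_assoc : ∀ a b c, m.mul (m.mul a b) c = m.mul a (m.mul b c)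
  one_mul : ∀ a, m.mul m.one a = a
  mul_one : ∀ a, m.mul a m.one = a
  coassoc : TensorProduct.assoc K A A A ∘ₗ m.comul.rTensor A ∘ₗ m.comul
    = m.comul.lTensor A ∘ₗ m.comul
  counit_rTensor : m.counit.rTensor A ∘ₗ m.comul = TensorProduct.mk K K A 1
  counit_lTensor : m.counit.lTensor A ∘ₗ m.comul = (TensorProduct.mk K A K).flip 1
  counit_one : m.counit m.one = 1
  counit_mul : ∀ a b, m.counit (m.mul a b) = m.counit a * m.counit b
  comul_one : m.comul m.one = m.one ⊗ₜ[K] m.one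
  comul_mul : ∀ a b,
    m.comul (m.mul a b) = TensorProduct.map₂ m.mul m.mul (m.comul a) (m.comul b)
  exists_antipode : ∃ S : A →ₗ[K] A,
    (∀ a, TensorProduct.lift m.mul (S.rTensor A (m.comul a)) = m.counit a • m.one) ∧
    (∀ a, TensorProduct.lift m.mul (S.lTensor A (m.comul a)) = m.counit a • m.one)

/-- The structure maps are compatible with the `ℕ`-grading `𝒜` of `A`. -/
structure IsGraded (m : StructureMaps K A) (𝒜 : ℕ → Submodule K A) : Prop where
  isInternal : DirectSum.IsInternal 𝒜
  one_mem : m.one ∈ 𝒜 0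
  mul_mem : ∀ i j, ∀ a ∈ 𝒜 i, ∀ b ∈ 𝒜 j, m.mul a b ∈ 𝒜 (i + j)
  comul_mem : ∀ n, ∀ a ∈ 𝒜 n, m.comul a ∈
    ⨆ p ∈ Finset.HasAntidiagonal.antidiagonal n, LinearMap.range (TensorProduct.mapIncl (𝒜 p.1) (𝒜 p.2))
  counit_eq_zero : ∀ n, n ≠ 0 → ∀ a ∈ 𝒜 n, m.counit a = 0

/-- The ring whose addition is that of `A` and whose product is `m.mul`. -/
abbrev IsHopf.ring {m : StructureMaps K A} (h : m.IsHopf) : Ring A :=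
  { (inferInstance : AddCommGroup A) with
    mul := fun a b => m.mul a b
    one := m.one
    mul_assoc := h.mul_assoc
    one_mul := h.one_mul
    mul_one := h.mul_one
    zero_mul := fun a => by change m.mul 0 a = 0; simp
    mul_zero := fun a => by change m.mul a 0 = 0; simp
    left_distrib := fun a b c => by change m.mul a (b + c) = m.mul a b + m.mul a c; simp
    right_distrib := fun a b c => by change m.mul (a + b) c = m.mul a c + m.mul b c; simp }

/-- The `K`-algebra with product `m.mul`. -/
abbrev IsHopf.algebra {m : StructureMaps K A} (h : m.IsHopf) :
    letI := h.ring
    Algebra K A :=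
  letI := h.ring
  Algebra.ofModule
    (fun r a b => by change m.mul (r • a) b = r • m.mul a b; simp)
    (fun r a b => by change m.mul a (r • b) = r • m.mul a b; simp)

/-- The Hopf algebra with structure maps `m`, in the sense of Mathlib. -/
noncomputable abbrev IsHopf.hopfAlgebra {m : StructureMaps K A} (h : m.IsHopf) :
    letI := h.ring
    HopfAlgebra K A :=
  letI := h.ring
  letI := h.algebra
  letI : Coalgebra K A :=
    { comul := m.comul
      counit := m.counit
      coassoc := h.coassoc
      rTensor_counit_comp_comul := h.counit_rTensor
      lTensor_counit_comp_comul := h.counit_lTensor }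
  letI : Bialgebra K A := Bialgebra.mk' K A h.counit_one (fun {a b} => h.counit_mul a b)
    h.comul_one (fun {a b} => by
      have key : ∀ x y : A ⊗[K] A, TensorProduct.map₂ m.mul m.mul x y = x * y := by
        intro x y
        induction x with
        | zero => simp
        | add x₁ x₂ h₁ h₂ => rw [map_add, LinearMap.add_apply, h₁, h₂, add_mul]
        | tmul a b =>
          induction y with
          | zero => simp
          | add y₁ y₂ h₁ h₂ => rw [map_add, h₁, h₂, mul_add]
          | tmul c d =>
            rw [TensorProduct.map₂_apply_tmul, TensorProduct.map_tmul,
              Algebra.TensorProduct.tmul_mul_tmul]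
            rfl
      exact (h.comul_mul a b).trans (key _ _))
  { antipode := h.exists_antipode.choose
    mul_antipode_rTensor_comul := by
      ext a
      exact (h.exists_antipode.choose_spec.1 a).trans
        (Algebra.algebraMap_eq_smul_one (A := A) (m.counit a)).symm
    mul_antipode_lTensor_comul := by
      ext a
      exact (h.exists_antipode.choose_spec.2 a).trans
        (Algebra.algebraMap_eq_smul_one (A := A) (m.counit a)).symm }

end StructureMaps

/-! ## Preordered forests -/

/-- A preordered forest: a finite rooted forest, given by its edges oriented towards the roots
(`edge v w` means `v → w`; every vertex has at most one outgoing edge and there are no cycles),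
together with a total preorder `le` on its vertices. -/
structure PreForest : Type 1 where
  V : Type
  finite : Finite V
  edge : V → V → Prop
  edge_unique : ∀ {v w w'}, edge v w → edge v w' → w = w'
  acyclic : ∀ v, ¬ Relation.TransGen edge v v
  le : V → V → Prop
  le_refl : ∀ v, le v v
  le_trans : ∀ {u v w}, le u v → le v w → le u w
  le_total : ∀ u v, le u v ∨ le v u

namespace PreForest

attribute [instance] PreForest.finite

/-- `F.reach v w`: there is an oriented path, possibly of length `0`, from `v` to `w`. -/
def reach (F : PreForest) (v w : F.V) : Prop := Relation.ReflTransGen F.edge v w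

/-- The number of vertices. -/
noncomputable def degree (F : PreForest) : ℕ := Nat.card F.V

/-- Heap-preordered forests: a vertex is strictly greater than the vertices strictly below it. -/
def IsHeap (F : PreForest) : Prop :=
  ∀ a b : F.V, a ≠ b → F.reach a b → F.le b a ∧ ¬ F.le a b

/-- The equivalence class of `u` for `x ≤ y ∧ y ≤ x`. -/
def eqClass (F : PreForest) (u : F.V) : Set F.V := {x | F.le x u ∧ F.le u x}

/-- The surjection `σ : V(F) → {1, …, q}` attached to the total preorder, where `q` is the number
of equivalence classes: `σ v` is the position of the class of `v` among the totally ordered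
equivalence classes, that is, the number of classes of elements `u ≤ v`. -/
noncomputable def rank (F : PreForest) (v : F.V) : ℕ := (F.eqClass '' {u | F.le u v}).ncard

/-- Isomorphisms of preordered forests. -/
structure Iso (F G : PreForest) where
  toEquiv : F.V ≃ G.V
  edge_iff : ∀ v w, G.edge (toEquiv v) (toEquiv w) ↔ F.edge v w
  le_iff : ∀ v w, G.le (toEquiv v) (toEquiv w) ↔ F.le v w

def Iso.refl (F : PreForest) : Iso F F := ⟨Equiv.refl _, fun _ _ => Iff.rfl, fun _ _ => Iff.rfl⟩

def Iso.symm {F G : PreForest} (e : Iso F G) : Iso G F where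
  toEquiv := e.toEquiv.symm
  edge_iff v w := by simpa using (e.edge_iff (e.toEquiv.symm v) (e.toEquiv.symm w)).symm
  le_iff v w := by simpa using (e.le_iff (e.toEquiv.symm v) (e.toEquiv.symm w)).symm

def Iso.trans {F G H : PreForest} (e : Iso F G) (e' : Iso G H) : Iso F H where
  toEquiv := e.toEquiv.trans e'.toEquiv
  edge_iff v w := (e'.edge_iff _ _).trans (e.edge_iff v w)
  le_iff v w := (e'.le_iff _ _).trans (e.le_iff v w)

instance isoSetoid : Setoid PreForest where
  r F G := Nonempty (Iso F G)
  iseqv := ⟨fun F => ⟨Iso.refl F⟩, fun ⟨e⟩ => ⟨e.symm⟩, fun ⟨e⟩ ⟨e'⟩ => ⟨e.trans e'⟩⟩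

/-- The empty forest. -/
def empty : PreForest where
  V := Empty
  finite := inferInstance
  edge _ _ := False
  edge_unique := fun h => h.elim
  acyclic v := v.elim
  le _ _ := True
  le_refl _ := trivial
  le_trans _ _ := trivial
  le_total v _ := v.elim

/-- The induced subforest on a set `s` of vertices, with the restricted preorder. -/
def restrict (F : PreForest) (s : Set F.V) : PreForest where
  V := s
  finite := inferInstance
  edge v w := F.edge v w
  edge_unique h h' := Subtype.ext (F.edge_unique h h')
  acyclic v h := F.acyclic v (h.lift Subtype.val fun _ _ hab => hab)
  le v w := F.le v w
  le_refl v := F.le_refl v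
  le_trans h h' := F.le_trans h h'
  le_total v w := F.le_total v w

/-- The product `F G`: disjoint union of the forests, the vertices of `F` being smaller than those
of `G`. -/
def prod (F G : PreForest) : PreForest where
  V := F.V ⊕ G.V
  finite := inferInstance
  edge := Sum.LiftRel F.edge G.edge
  edge_unique := by
    rintro _ _ _ (h | h) h'
    · cases h' with | inl h' => rw [F.edge_unique h h']
    · cases h' with | inr h' => rw [G.edge_unique h h']
  acyclic := by
    have hl : ∀ (v : F.V) (y : F.V ⊕ G.V), Relation.TransGen (Sum.LiftRel F.edge G.edge)
        (Sum.inl v) y → ∃ w, y = Sum.inl w ∧ Relation.TransGen F.edge v w := by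
      intro v y h
      induction h with
      | single h => cases h with | inl h => exact ⟨_, rfl, .single h⟩
      | tail _ h ih =>
        obtain ⟨w, rfl, hw⟩ := ih
        cases h with | inl h => exact ⟨_, rfl, hw.tail h⟩
    have hr : ∀ (v : G.V) (y : F.V ⊕ G.V), Relation.TransGen (Sum.LiftRel F.edge G.edge)
        (Sum.inr v) y → ∃ w, y = Sum.inr w ∧ Relation.TransGen G.edge v w := by
      intro v y h
      induction h with
      | single h => cases h with | inr h => exact ⟨_, rfl, .single h⟩
      | tail _ h ih =>
        obtain ⟨w, rfl, hw⟩ := ih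
        cases h with | inr h => exact ⟨_, rfl, hw.tail h⟩
    rintro (v | v) h
    · obtain ⟨w, hw, h'⟩ := hl v _ h
      cases hw; exact F.acyclic v h'
    · obtain ⟨w, hw, h'⟩ := hr v _ h
      cases hw; exact G.acyclic v h'
  le := Sum.Lex F.le G.le
  le_refl := by
    rintro (v | v)
    · exact .inl (F.le_refl v)
    · exact .inr (G.le_refl v)
  le_trans := by
    rintro _ _ _ (h | h | _) h'
    · cases h' with
      | inl h' => exact .inl (F.le_trans h h')
      | sep => exact .sep _ _
    · cases h' with | inr h' => exact .inr (G.le_trans h h')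
    · cases h' with | inr h' => exact .sep _ _
  le_total := by
    rintro (v | v) (w | w)
    · exact (F.le_total v w).imp .inl .inl
    · exact .inl (.sep _ _)
    · exact .inr (.sep _ _)
    · exact (G.le_total v w).imp .inr .inr

/-- Admissible cuts: sets of vertices no two different elements of which are joined by an oriented
path. The empty cut and the total cut are included. -/
def Cut (F : PreForest) : Type :=
  {v : Set F.V // ∀ a ∈ v, ∀ b ∈ v, a ≠ b → ¬ F.reach a b}

noncomputable instance (F : PreForest) : Fintype F.Cut :=
  haveI : Finite F.Cut := Subtype.finite
  Fintype.ofFinite _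

/-- The vertices above the cut. -/
def leaSet (F : PreForest) (v : F.Cut) : Set F.V := {w | ∃ x ∈ v.1, F.reach w x}

/-- The part of `F` above the cut. -/
def lea (F : PreForest) (v : F.Cut) : PreForest := F.restrict (F.leaSet v)

/-- The part of `F` that remains below the cut. -/
def roo (F : PreForest) (v : F.Cut) : PreForest := F.restrict (F.leaSet v)ᶜ

/-! Compatibility of these constructions with isomorphisms -/

theorem Iso.reach_of {F G : PreForest} (e : Iso F G) {v w : F.V} (h : F.reach v w) :
    G.reach (e.toEquiv v) (e.toEquiv w) :=
  Relation.ReflTransGen.lift (p := G.edge) e.toEquiv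
    (fun a b hab => (e.edge_iff a b).2 hab) _ _ h

theorem Iso.reach_iff {F G : PreForest} (e : Iso F G) (v w : F.V) :
    G.reach (e.toEquiv v) (e.toEquiv w) ↔ F.reach v w :=
  ⟨fun h => by simpa [Iso.symm] using e.symm.reach_of h, e.reach_of⟩

theorem Iso.rank_eq {F G : PreForest} (e : Iso F G) (v : F.V) :
    G.rank (e.toEquiv v) = F.rank v := by
  have hc : ∀ u, G.eqClass (e.toEquiv u) = e.toEquiv '' F.eqClass u := by
    intro u
    ext x
    obtain ⟨x, rfl⟩ := e.toEquiv.surjective x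
    simp [eqClass, e.le_iff]
  have hs : G.eqClass '' {u | G.le u (e.toEquiv v)}
      = (fun s : Set F.V => e.toEquiv '' s) '' (F.eqClass '' {u | F.le u v}) := by
    ext s
    simp only [Set.mem_image, Set.mem_ofPred_eq, exists_exists_and_eq_and]
    constructor
    · rintro ⟨u, hu, rfl⟩
      obtain ⟨u, rfl⟩ := e.toEquiv.surjective u
      exact ⟨u, (e.le_iff _ _).1 hu, (hc u).symm⟩
    · rintro ⟨u, hu, rfl⟩
      exact ⟨e.toEquiv u, (e.le_iff _ _).2 hu, hc u⟩
  rw [rank, hs, Set.ncard_image_of_injective _ e.toEquiv.injective.image_injective, rank]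

theorem Iso.isHeap {F G : PreForest} (e : Iso F G) (h : F.IsHeap) : G.IsHeap := by
  intro a b hab hr
  obtain ⟨a, rfl⟩ := e.toEquiv.surjective a
  obtain ⟨b, rfl⟩ := e.toEquiv.surjective b
  rw [e.le_iff, e.le_iff]
  exact h a b (fun hh => hab (by rw [hh])) ((e.reach_iff a b).1 hr)

theorem restrict_equiv {F G : PreForest} (e : Iso F G) (s : Set F.V) (t : Set G.V)
    (h : ∀ a, a ∈ s ↔ e.toEquiv a ∈ t) : F.restrict s ≈ G.restrict t :=
  ⟨⟨e.toEquiv.subtypeEquiv h, fun v w => e.edge_iff v.1 w.1, fun v w => e.le_iff v.1 w.1⟩⟩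

theorem prod_equiv {F F' G G' : PreForest} (hF : F ≈ F') (hG : G ≈ G') :
    F.prod G ≈ F'.prod G' := by
  obtain ⟨e⟩ := hF
  obtain ⟨e'⟩ := hG
  refine ⟨⟨Equiv.sumCongr e.toEquiv e'.toEquiv, ?_, ?_⟩⟩
  · rintro (v | v) (w | w)
    · exact Sum.liftRel_inl_inl.trans ((e.edge_iff v w).trans Sum.liftRel_inl_inl.symm)
    · exact iff_of_false Sum.not_liftRel_inl_inr Sum.not_liftRel_inl_inr
    · exact iff_of_false Sum.not_liftRel_inr_inl Sum.not_liftRel_inr_inl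
    · exact Sum.liftRel_inr_inr.trans ((e'.edge_iff v w).trans Sum.liftRel_inr_inr.symm)
  · rintro (v | v) (w | w)
    · exact Sum.lex_inl_inl.trans ((e.le_iff v w).trans Sum.lex_inl_inl.symm)
    · exact iff_of_true (Sum.Lex.sep _ _) (Sum.Lex.sep _ _)
    · exact iff_of_false Sum.lex_inr_inl Sum.lex_inr_inl
    · exact Sum.lex_inr_inr.trans ((e'.le_iff v w).trans Sum.lex_inr_inr.symm)

def Iso.cutEquiv {F G : PreForest} (e : Iso F G) : F.Cut ≃ G.Cut :=
  (Equiv.Set.congr e.toEquiv).subtypeEquiv fun _ => by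
    constructor
    · rintro h _ ⟨a, ha, rfl⟩ _ ⟨b, hb, rfl⟩ hab hr
      exact h a ha b hb (fun hh => hab (by rw [hh])) ((e.reach_iff a b).1 hr)
    · intro h a ha b hb hab hr
      exact h _ ⟨a, ha, rfl⟩ _ ⟨b, hb, rfl⟩ (e.toEquiv.injective.ne hab) (e.reach_of hr)

theorem Iso.mem_leaSet {F G : PreForest} (e : Iso F G) (v : F.Cut) (a : F.V) :
    a ∈ F.leaSet v ↔ e.toEquiv a ∈ G.leaSet (e.cutEquiv v) := by
  constructor
  · rintro ⟨x, hx, h⟩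
    exact ⟨e.toEquiv x, ⟨x, hx, rfl⟩, e.reach_of h⟩
  · rintro ⟨_, ⟨x, hx, rfl⟩, h⟩
    exact ⟨x, hx, (e.reach_iff a x).1 h⟩

theorem restrict_reach {F : PreForest} {s : Set F.V} {a b : (F.restrict s).V}
    (h : (F.restrict s).reach a b) : F.reach a.1 b.1 :=
  Relation.ReflTransGen.lift (p := F.edge) Subtype.val (fun _ _ hab => hab) _ _ h

theorem IsHeap.restrict {F : PreForest} (h : F.IsHeap) (s : Set F.V) : (F.restrict s).IsHeap :=
  fun a b hab hr => h a.1 b.1 (fun hh => hab (Subtype.ext hh)) (restrict_reach hr)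

theorem IsHeap.prod {F G : PreForest} (hF : F.IsHeap) (hG : G.IsHeap) : (F.prod G).IsHeap := by
  have hl : ∀ (v : F.V) (y : F.V ⊕ G.V), (F.prod G).reach (Sum.inl v) y →
      ∃ w, y = Sum.inl w ∧ F.reach v w := by
    intro v y h
    induction h with
    | refl => exact ⟨v, rfl, .refl⟩
    | tail _ h ih =>
      obtain ⟨w, rfl, hw⟩ := ih
      cases h with | inl h => exact ⟨_, rfl, hw.tail h⟩
  have hr : ∀ (v : G.V) (y : F.V ⊕ G.V), (F.prod G).reach (Sum.inr v) y →
      ∃ w, y = Sum.inr w ∧ G.reach v w := by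
    intro v y h
    induction h with
    | refl => exact ⟨v, rfl, .refl⟩
    | tail _ h ih =>
      obtain ⟨w, rfl, hw⟩ := ih
      cases h with | inr h => exact ⟨_, rfl, hw.tail h⟩
  rintro (a | a) b hab h
  · obtain ⟨b, rfl, h'⟩ := hl a b h
    have := hF a b (fun hh => hab (by rw [hh])) h'
    simpa [PreForest.prod] using this
  · obtain ⟨b, rfl, h'⟩ := hr a b h
    have := hG a b (fun hh => hab (by rw [hh])) h'
    simpa [PreForest.prod] using this

theorem isHeap_empty : empty.IsHeap := fun a => a.elim

end PreForest

/-- Preordered forests up to isomorphism. -/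
abbrev ForestClass : Type 1 := Quotient PreForest.isoSetoid

namespace ForestClass

def empty : ForestClass := ⟦PreForest.empty⟧

def prod (c d : ForestClass) : ForestClass :=
  Quotient.map₂ PreForest.prod (fun _ _ h _ _ h' => PreForest.prod_equiv h h') c d

noncomputable def degree (c : ForestClass) : ℕ :=
  Quotient.lift PreForest.degree (fun F G (h : Nonempty (F.Iso G)) =>
    h.elim fun e => Nat.card_congr e.toEquiv) c

def IsHeap (c : ForestClass) : Prop :=
  Quotient.lift PreForest.IsHeap (fun F G (h : Nonempty (F.Iso G)) =>
    h.elim fun e => propext ⟨e.isHeap, e.symm.isHeap⟩) c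

end ForestClass

/-- The vector space with basis the preordered forests. -/
def Hpo (K : Type*) [Field K] := ForestClass →₀ K

noncomputable instance (K : Type*) [Field K] : AddCommGroup (Hpo K) :=
  inferInstanceAs (AddCommGroup (ForestClass →₀ K))

noncomputable instance (K : Type*) [Field K] : Module K (Hpo K) :=
  inferInstanceAs (Module K (ForestClass →₀ K))

namespace Hpo

variable (K : Type*) [Field K]

/-- The basis of `Hpo K`. -/
noncomputable def basis : Module.Basis ForestClass K (Hpo K) :=
  ⟨LinearEquiv.refl K (ForestClass →₀ K)⟩

/-- The cut coproduct of a forest: the sum of `Lea_v(F) ⊗ Roo_v(F)` over the admissible cuts. -/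
noncomputable def comulClass (c : ForestClass) : Hpo K ⊗[K] Hpo K :=
  Quotient.lift
    (fun F : PreForest => ∑ v : F.Cut,
      basis K ⟦F.lea v⟧ ⊗ₜ[K] basis K ⟦F.roo v⟧)
    (by
      rintro F G ⟨e⟩
      refine Fintype.sum_equiv e.cutEquiv _ _ fun v => ?_
      have h₁ : (⟦F.lea v⟧ : ForestClass) = ⟦G.lea (e.cutEquiv v)⟧ :=
        Quotient.sound (PreForest.restrict_equiv e _ _ (e.mem_leaSet v))
      have h₂ : (⟦F.roo v⟧ : ForestClass) = ⟦G.roo (e.cutEquiv v)⟧ :=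
        Quotient.sound (PreForest.restrict_equiv e _ _ fun a => not_congr (e.mem_leaSet v a))
      rw [h₁, h₂]) c

/-- The product, unit, cut coproduct and counit of the algebra of preordered forests. -/
noncomputable def maps : StructureMaps K (Hpo K) where
  mul := (basis K).constr K fun c => (basis K).constr K fun d => basis K (c.prod d)
  one := basis K ForestClass.empty
  comul := (basis K).constr K (comulClass K)
  counit := (basis K).coord ForestClass.empty

/-- The homogeneous component of degree `n`: the span of the forests with `n` vertices. -/
noncomputable def grading (n : ℕ) : Submodule K (Hpo K) :=
  Submodule.span K (Hpo.basis K '' {c : ForestClass | c.degree = n})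

end Hpo

/-- The subspace of `Hpo K` spanned by the heap-preordered forests. -/
noncomputable def Hhpo (K : Type*) [Field K] : Submodule K (Hpo K) :=
  Submodule.span K (Hpo.basis K '' {c : ForestClass | c.IsHeap})

namespace Hhpo

variable (K : Type*) [Field K]

theorem single_mem {c : ForestClass} (hc : c.IsHeap) :
    Hpo.basis K c ∈ Hhpo K :=
  Submodule.subset_span ⟨c, hc, rfl⟩

theorem one_mem : (Hpo.maps K).one ∈ Hhpo K := single_mem K PreForest.isHeap_empty

theorem mul_mem {x y : Hpo K} (hx : x ∈ Hhpo K) (hy : y ∈ Hhpo K) :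
    (Hpo.maps K).mul x y ∈ Hhpo K := by
  refine Submodule.span_induction₂ (p := fun x y _ _ => (Hpo.maps K).mul x y ∈ Hhpo K)
    ?_ ?_ ?_ ?_ ?_ ?_ ?_ hx hy
  · rintro _ _ ⟨c, hc, rfl⟩ ⟨d, hd, rfl⟩
    have : (Hpo.maps K).mul (Hpo.basis K c) (Hpo.basis K d)
        = Hpo.basis K (c.prod d) := by
      simp [Hpo.maps]
    simp only [this]
    induction c, d using Quotient.inductionOn₂ with
    | h F G => exact single_mem K (PreForest.IsHeap.prod hc hd)
  · intro y _; simp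
  · intro x _; simp
  · intro x y z _ _ _ h h'; simpa using add_mem h h'
  · intro x y z _ _ _ h h'; simpa using add_mem h h'
  · intro r x y _ _ h; simpa using Submodule.smul_mem _ r h
  · intro r x y _ _ h; simpa using Submodule.smul_mem _ r h

/-- The inclusion of `Hhpo K ⊗ Hhpo K` into `Hpo K ⊗ Hpo K`. -/
noncomputable abbrev tensorIncl : Hhpo K ⊗[K] Hhpo K →ₗ[K] Hpo K ⊗[K] Hpo K :=
  TensorProduct.mapIncl (Hhpo K) (Hhpo K)

theorem tensorIncl_injective : Function.Injective (tensorIncl K) :=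
  haveI : Module.Free K (Hhpo K) := Module.Free.of_divisionRing K (Hhpo K)
  TensorProduct.map_injective_of_flat_flat _ _ Subtype.val_injective Subtype.val_injective

theorem comul_mem (x : Hhpo K) : (Hpo.maps K).comul x ∈ LinearMap.range (tensorIncl K) := by
  obtain ⟨x, hx⟩ := x
  induction hx using Submodule.span_induction with
  | mem x hx =>
    obtain ⟨c, hc, rfl⟩ := hx
    have : (Hpo.maps K).comul (Hpo.basis K c) = Hpo.comulClass K c := by simp [Hpo.maps]
    simp only [this]
    induction c using Quotient.inductionOn with
    | h F =>
      refine Submodule.sum_mem _ fun v _ => ?_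
      have h₁ : ForestClass.IsHeap ⟦F.lea v⟧ := PreForest.IsHeap.restrict (F := F) hc _
      have h₂ : ForestClass.IsHeap ⟦F.roo v⟧ := PreForest.IsHeap.restrict (F := F) hc _
      exact ⟨⟨_, single_mem K h₁⟩ ⊗ₜ[K] ⟨_, single_mem K h₂⟩, rfl⟩
  | zero => simp
  | add x y _ _ h h' => simpa using add_mem h h'
  | smul r x _ h => simpa using Submodule.smul_mem _ r h

/-- The product, unit, coproduct and counit of `Hpo K` restricted to `Hhpo K`. -/
noncomputable def maps : StructureMaps K (Hhpo K) where
  mul := LinearMap.mk₂ K (fun x y => ⟨(Hpo.maps K).mul x y, mul_mem K x.2 y.2⟩)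
    (fun _ _ _ => Subtype.ext (by simp)) (fun _ _ _ => Subtype.ext (by simp))
    (fun _ _ _ => Subtype.ext (by simp)) (fun _ _ _ => Subtype.ext (by simp))
  one := ⟨(Hpo.maps K).one, one_mem K⟩
  comul := (LinearEquiv.ofInjective (tensorIncl K) (tensorIncl_injective K)).symm.toLinearMap ∘ₗ
    ((Hpo.maps K).comul ∘ₗ (Hhpo K).subtype).codRestrict _ (comul_mem K)
  counit := (Hpo.maps K).counit ∘ₗ (Hhpo K).subtype

/-- The restricted coproduct is the coproduct of `Hpo K`, with values in `Hhpo K ⊗ Hhpo K`. -/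
theorem tensorIncl_comul (x : Hhpo K) :
    tensorIncl K ((maps K).comul x) = (Hpo.maps K).comul x := by
  exact congrArg Subtype.val ((LinearEquiv.ofInjective (tensorIncl K)
    (tensorIncl_injective K)).apply_symm_apply
      (((Hpo.maps K).comul ∘ₗ (Hhpo K).subtype).codRestrict _ (comul_mem K) x))

/-- The homogeneous component of degree `n`. -/
noncomputable def grading (n : ℕ) : Submodule K (Hhpo K) := (Hpo.grading K n).comap (Hhpo K).subtype

end Hhpo

/-! ## Packed words -/

/-- A packed word `σ(1) … σ(n)`: the set of its letters is `{1, …, k}` for some `k`. -/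
structure PackedWord where
  word : List ℕ
  packed : ∃ k, ∀ a, a ∈ word ↔ 1 ≤ a ∧ a ≤ k

/-- The `i`-th smallest letter of `w` is replaced by `i`. -/
def pack (w : List ℕ) : List ℕ := w.map fun a => (w.toFinset.filter (· ≤ a)).card

theorem pack_packed (w : List ℕ) : ∃ k, ∀ a, a ∈ pack w ↔ 1 ≤ a ∧ a ≤ k := by
  set s := w.toFinset with hs
  have hinj : Set.InjOn (fun a => (s.filter (· ≤ a)).card) s := by
    have key : ∀ a ∈ s, ∀ b ∈ s, a < b → (s.filter (· ≤ a)).card < (s.filter (· ≤ b)).card := by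
      intro a _ b hb hab
      refine Finset.card_lt_card (Finset.ssubset_iff_of_subset ?_ |>.2 ⟨b, ?_, ?_⟩)
      · intro x hx
        simp only [Finset.mem_filter] at hx ⊢
        exact ⟨hx.1, hx.2.trans hab.le⟩
      · simp [hb]
      · simp [hab]
    intro a ha b hb hab
    rcases lt_trichotomy a b with h | h | h
    · exact absurd hab (key a ha b hb h).ne
    · exact h
    · exact absurd hab (key b hb a ha h).ne'
  have himg : s.image (fun a => (s.filter (· ≤ a)).card) = Finset.Icc 1 s.card := by
    refine Finset.eq_of_subset_of_card_le ?_ ?_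
    · intro x hx
      obtain ⟨a, ha, rfl⟩ := Finset.mem_image.1 hx
      rw [Finset.mem_Icc]
      exact ⟨Finset.card_pos.2 ⟨a, by simp [ha]⟩, Finset.card_filter_le _ _⟩
    · rw [Finset.card_image_of_injOn hinj]; simp
  refine ⟨s.card, fun a => ?_⟩
  rw [← Finset.mem_Icc, ← himg]
  simp [pack, hs]

def packWord (w : List ℕ) : PackedWord := ⟨pack w, pack_packed w⟩

/-- The list (with multiplicities) of all shufflings of two words. -/
def shuffles : List ℕ → List ℕ → List (List ℕ)
  | [], v => [v]
  | u, [] => [u]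
  | a :: u, b :: v =>
    (shuffles u (b :: v)).map (a :: ·) ++ (shuffles (a :: u) v).map (b :: ·)
termination_by u v => u.length + v.length

namespace PackedWord

def empty : PackedWord := ⟨[], 0, by simp; omega⟩

/-- The length. -/
def length (τ : PackedWord) : ℕ := τ.word.length

/-- The largest letter (`0` for the empty word). -/
def max (τ : PackedWord) : ℕ := τ.word.foldr Max.max 0

end PackedWord

/-- The vector space with basis the packed words. -/
def WQSym (K : Type*) [Field K] := PackedWord →₀ K

noncomputable instance (K : Type*) [Field K] : AddCommGroup (WQSym K) :=
  inferInstanceAs (AddCommGroup (PackedWord →₀ K))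

noncomputable instance (K : Type*) [Field K] : Module K (WQSym K) :=
  inferInstanceAs (Module K (PackedWord →₀ K))

namespace WQSym

variable (K : Type*) [Field K]

/-- The basis of `WQSym K`. -/
noncomputable def basis : Module.Basis PackedWord K (WQSym K) :=
  ⟨LinearEquiv.refl K (PackedWord →₀ K)⟩

/-- The product of two packed words: the letters of `τ` are shifted by `max σ`, and all the
shufflings of the two words are summed. (These shufflings are packed words, so that `packWord`
does not change them.) -/
noncomputable def mulWord (σ τ : PackedWord) : WQSym K :=
  ((shuffles σ.word (τ.word.map (· + σ.max))).map
    fun w => basis K (packWord w)).sum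

/-- The coproduct of a packed word: the word is cut at all possible places and the two parts are
packed. -/
noncomputable def comulWord (σ : PackedWord) : WQSym K ⊗[K] WQSym K :=
  ∑ k ∈ Finset.range (σ.length + 1),
    basis K (packWord (σ.word.take k)) ⊗ₜ[K] basis K (packWord (σ.word.drop k))

/-- The product, unit, coproduct and counit of the algebra of free packed words, the graded dual
of the algebra of word quasi-symmetric functions. -/
noncomputable def maps : StructureMaps K (WQSym K) where
  mul := (basis K).constr K fun σ => (basis K).constr K fun τ => mulWord K σ τ
  one := basis K PackedWord.empty
  comul := (basis K).constr K (comulWord K)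
  counit := (basis K).coord PackedWord.empty

/-- The homogeneous component of degree `n`: the span of the packed words of length `n`. -/
noncomputable def grading (n : ℕ) : Submodule K (WQSym K) :=
  Submodule.span K (basis K '' {σ : PackedWord | σ.length = n})

end WQSym

/-! ## The map from forests to packed words -/

namespace PreForest

/-- The set `S_F^τ` of bijections `φ : V(F) → {1, …, n}`, `n` the length of `τ`, such that
`σ(v) = τ(φ(v))` for every vertex `v`, and `φ(v) ≥ φ(v')` whenever there is an oriented path from
`v'` to `v`. It is empty if `F` does not have `n` vertices. -/
def linearizations (F : PreForest) (τ : PackedWord) : Set (F.V ≃ Fin τ.word.length) :=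
  {φ | (∀ v, F.rank v = τ.word.get (φ v)) ∧ ∀ v v', F.reach v' v → φ v' ≤ φ v}

theorem Iso.card_linearizations {F G : PreForest} (e : Iso F G) (τ : PackedWord) :
    Nat.card (F.linearizations τ) = Nat.card (G.linearizations τ) := by
  refine Nat.card_congr ((Equiv.equivCongr e.toEquiv (Equiv.refl _)).subtypeEquiv fun φ => ?_)
  simp only [linearizations, Set.mem_ofPred_eq]
  refine and_congr ?_ ?_
  · rw [← e.toEquiv.forall_congr_right]
    simp [Equiv.equivCongr, e.rank_eq]
  · rw [← e.toEquiv.forall_congr_right]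
    refine forall_congr' fun v => ?_
    rw [← e.toEquiv.forall_congr_right]
    simp [Equiv.equivCongr, e.reach_iff]

theorem finite_linearizations (F : PreForest) :
    {τ : PackedWord | Nat.card (F.linearizations τ) ≠ 0}.Finite := by
  have hinj : Function.Injective PackedWord.word := by
    rintro ⟨w, _⟩ ⟨w', _⟩ rfl; rfl
  refine Set.Finite.of_finite_image (f := PackedWord.word) ?_ hinj.injOn
  refine (Set.finite_range fun φ : F.V ≃ Fin (Nat.card F.V) =>
    List.ofFn fun i => F.rank (φ.symm i)).subset ?_
  rintro _ ⟨τ, hτ, rfl⟩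
  obtain ⟨⟨φ, hφ, -⟩⟩ := (Nat.card_ne_zero.1 hτ).1
  have hn : τ.word.length = Nat.card F.V := by simpa using (Nat.card_congr φ).symm
  refine ⟨φ.trans (finCongr hn), List.ext_getElem (by simp [hn]) fun i h₁ h₂ => ?_⟩
  simp [hφ, finCongr]

/-- The element `∑ card(S_F^τ) τ` of `WQSym K`, the sum being over all packed words `τ`. -/
noncomputable def wordSum (K : Type*) [Field K] (F : PreForest) : WQSym K :=
  (WQSym.basis K).repr.symm <| Finsupp.ofSupportFinite (fun τ => (Nat.card (F.linearizations τ) : K))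
    (F.finite_linearizations.subset fun τ hτ h => hτ (by simp [h]))

end PreForest

/-- The linear map `Φ : Hpo K → WQSym K` that sends a preordered forest `F` to
`∑ card(S_F^τ) τ`. -/
noncomputable def Phi (K : Type*) [Field K] : Hpo K →ₗ[K] WQSym K :=
  (Hpo.basis K).constr K fun c : ForestClass =>
    Quotient.lift (PreForest.wordSum K)
      (fun F G (h : Nonempty (F.Iso G)) => h.elim fun e =>
        congrArg (WQSym.basis K).repr.symm <| Finsupp.ext fun τ => congrArg (Nat.cast : ℕ → K) (e.card_linearizations τ)) c

/-! ## Linear algebra and connected graded bialgebras -/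

/-! A bijection `φ` in `S_F^τ` is encoded by the list `φ⁻¹(1), …, φ⁻¹(n)`, a linear extension of `F`
in which every vertex comes after its descendants. Then `Φ(F)` is the sum, over all linear
extensions, of the words of ranks read along them (`wordSum_eq_sum`). Compatibility with the
operations becomes combinatorics of lists. The linear extensions of `FG` are the shuffles of one of
`F` with one of `G` (`sum_linExt_prod`). Cutting a linear extension in two amounts to choosing an
admissible cut and a linear extension of each part, because prefixes are closed under descendants
and such sets correspond to cuts (`sum_cut_linExt`).

The Hopf axioms then travel along `Φ` in both directions. On all of `Hpo` the map is surjective,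
each packed word being the image of a chain (`Phi_ladder`). So associativity, the unit laws and
multiplicativity of the coproduct and counit, which are transparent for forests, pass to words.
Coassociativity and the counit laws are checked on words, where the coproduct is deconcatenation.
Finally everything is pulled back to `Hhpo` along the injective restriction of `Φ`, so
coassociativity of cuts is never checked on forests. Antipodes exist because both bialgebras are
graded and connected: the convolution inverse of the identity is a locally finite geometric series.
Bialgebra morphisms respect antipodes by uniqueness of convolution inverses.

Injectivity is triangularity. Compare words lexicographically from right to left. In the largest
word read by a heap-preordered forest, the successor of a vertex `v` is the first later vertex of
smaller rank; otherwise `v` could be moved to the right of a smaller letter, which would enlarge the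
word. The largest word therefore determines the forest (`equiv_of_isLeading`). Its coefficient is a
positive count, nonzero in characteristic zero, so distinct forests have distinct leading terms and
their images are independent. -/

/-- Disjoint parts of a basis span independent subspaces, and injectivity pulls this back. Used with
the identity for words and with the inclusion of `Hhpo` for forests. -/
theorem iSupIndep_comap_span_basis {ι K M N : Type*} [Field K] [AddCommGroup M] [Module K M]
    [AddCommGroup N] [Module K N] (b : Module.Basis ι K M) (deg : ι → ℕ) (f : N →ₗ[K] M)
    (hf : Function.Injective f) :
    iSupIndep fun n => (Submodule.span K (b '' {i | deg i = n})).comap f := by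
  rw [iSupIndep_def]
  intro n
  have h₁ : (⨆ (j) (_ : j ≠ n), (Submodule.span K (b '' {i | deg i = j})).comap f)
      ≤ (Submodule.span K (b '' {i | deg i ≠ n})).comap f := by
    refine iSup₂_le fun j hj => Submodule.comap_mono (Submodule.span_mono (Set.image_mono ?_))
    rintro i rfl
    exact hj
  refine Disjoint.mono_right h₁ ?_
  have h₂ := b.linearIndependent.disjoint_span_image (s := {i | deg i = n})
    (t := {i | deg i ≠ n}) (Set.disjoint_left.2 fun i h h' => h' h)
  rw [Submodule.disjoint_def] at h₂ ⊢
  intro x hx hx'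
  exact hf (by simpa using h₂ _ hx hx')

/-! ### Convolution inverses and antipodes -/

section Convolution

open WithConv Coalgebra

variable {K C A : Type*} [Field K]

/-- In `J * J ^ n` on degree `k < n + 1`, a component of bidegree `(0, k)` is killed by `J`; in
every other one the second factor has degree less than `n` and is killed by `J ^ n`. -/
theorem convPow_eq_zero_of_mem [Ring A] [Algebra K A] [AddCommGroup C] [Module K C] [Coalgebra K C]
    (𝒞 : ℕ → Submodule K C)
    (hcomul : ∀ n, ∀ a ∈ 𝒞 n, comul (R := K) a ∈ ⨆ p ∈ Finset.HasAntidiagonal.antidiagonal n,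
      LinearMap.range (TensorProduct.mapIncl (𝒞 p.1) (𝒞 p.2)))
    (J : WithConv (C →ₗ[K] A)) (hJ : ∀ a ∈ 𝒞 0, J a = 0) (n k : ℕ) (hk : k < n) :
    ∀ a ∈ 𝒞 k, (J ^ n) a = 0 := by
  induction n generalizing k with
  | zero => omega
  | succ n ih =>
    intro a ha
    rw [pow_succ', LinearMap.convMul_apply]
    have h₁ : (⨆ p ∈ Finset.HasAntidiagonal.antidiagonal k,
        LinearMap.range (TensorProduct.mapIncl (𝒞 p.1) (𝒞 p.2)))
        ≤ LinearMap.ker (TensorProduct.map J.ofConv (J ^ n).ofConv) := by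
      refine iSup₂_le fun p hp => ?_
      rintro _ ⟨t, rfl⟩
      rw [LinearMap.mem_ker]
      induction t with
      | zero => simp
      | add x y hx hy => rw [map_add, map_add, hx, hy, add_zero]
      | tmul x y =>
        rw [TensorProduct.mapIncl, TensorProduct.map_tmul, TensorProduct.map_tmul]
        have hp' := Finset.HasAntidiagonal.mem_antidiagonal.1 hp
        obtain ⟨x, hx⟩ := x
        rcases Nat.eq_zero_or_pos p.1 with h | h
        · rw [h] at hx
          simp [hJ x hx]
        · simp [ih p.2 (by omega) y y.2]
    have h₂ : TensorProduct.map J.ofConv (J ^ n).ofConv (comul a) = 0 := h₁ (hcomul k a ha)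
    rw [h₂, map_zero]

/-- If every vector is killed by large convolution powers of `J`, then `1 - J` is invertible for the
convolution product. -/
theorem exists_conv_inverse_one_sub [Ring A] [Algebra K A] [AddCommGroup C] [Module K C]
    [Coalgebra K C] (J : WithConv (C →ₗ[K] A)) (hJ : ∀ a, ∃ N, ∀ n ≥ N, (J ^ n) a = 0) :
    ∃ S : WithConv (C →ₗ[K] A), S * (1 - J) = 1 ∧ (1 - J) * S = 1 := by
  choose N hN using hJ
  -- Partial sums of the geometric series. At `a` they are constant from `N a` on, and `S` is their
  -- pointwise limit.
  set G : ℕ → WithConv (C →ₗ[K] A) := fun M => ∑ n ∈ Finset.range M, J ^ n with hG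
  have hGa : ∀ M a, G M a = ∑ n ∈ Finset.range M, (J ^ n) a := by
    intro M a
    simp [hG]
  have hst : ∀ a M, N a ≤ M → G M a = G (N a) a := by
    intro a M hM
    rw [hGa, hGa]
    refine (Finset.sum_subset (Finset.range_subset_range.2 hM) fun n _ hn => hN a n ?_).symm
    simpa using hn
  have hadd : ∀ a b, G (N (a + b)) (a + b) = G (N a) a + G (N b) b := by
    intro a b
    have h₁ : N (a + b) ≤ max (N (a + b)) (max (N a) (N b)) := le_max_left _ _
    have h₂ : N a ≤ max (N (a + b)) (max (N a) (N b)) := (le_max_left _ _).trans (le_max_right _ _)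
    have h₃ : N b ≤ max (N (a + b)) (max (N a) (N b)) := (le_max_right _ _).trans (le_max_right _ _)
    rw [← hst _ _ h₁, ← hst _ _ h₂, ← hst _ _ h₃, map_add]
  have hsmul : ∀ (r : K) a, G (N (r • a)) (r • a) = r • G (N a) a := by
    intro r a
    rw [← hst _ _ (le_max_left (N (r • a)) (N a)), ← hst _ _ (le_max_right (N (r • a)) (N a)),
      map_smul]
  let S : C →ₗ[K] A :=
    { toFun := fun a => G (N a) a
      map_add' := hadd
      map_smul' := hsmul }
  have hS : ∀ a M, N a ≤ M → S a = (G M).ofConv a := fun a M hM => (hst a M hM).symm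
  -- A tensor is a finite sum, so on it `S` can be replaced by a single partial sum `G M`, for which
  -- the product with `1 - J` telescopes.
  have htl : ∀ (f : C →ₗ[K] A) (t : C ⊗[K] C), ∃ N', ∀ M ≥ N',
      TensorProduct.map S f t = TensorProduct.map (G M).ofConv f t := by
    intro f t
    induction t with
    | zero => exact ⟨0, by simp⟩
    | add x y hx hy =>
      obtain ⟨a, ha⟩ := hx
      obtain ⟨b, hb⟩ := hy
      exact ⟨max a b, fun M hM => by
        rw [map_add, map_add, ha M (le_trans (le_max_left _ _) hM),
          hb M (le_trans (le_max_right _ _) hM)]⟩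
    | tmul x y => exact ⟨N x, fun M hM => by simp [hS x M hM]⟩
  have htr : ∀ (f : C →ₗ[K] A) (t : C ⊗[K] C), ∃ N', ∀ M ≥ N',
      TensorProduct.map f S t = TensorProduct.map f (G M).ofConv t := by
    intro f t
    induction t with
    | zero => exact ⟨0, by simp⟩
    | add x y hx hy =>
      obtain ⟨a, ha⟩ := hx
      obtain ⟨b, hb⟩ := hy
      exact ⟨max a b, fun M hM => by
        rw [map_add, map_add, ha M (le_trans (le_max_left _ _) hM),
          hb M (le_trans (le_max_right _ _) hM)]⟩
    | tmul x y => exact ⟨N y, fun M hM => by simp [hS y M hM]⟩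
  have hend : ∀ a M, N a ≤ M → (1 - J ^ M) a = (1 : WithConv (C →ₗ[K] A)) a := by
    intro a M hM
    have := hN a M hM
    simp only [WithConv.ofConv_sub, LinearMap.sub_apply, this, sub_zero]
  refine ⟨toConv S, ?_, ?_⟩
  · ext a
    obtain ⟨N', h⟩ := htl (1 - J).ofConv (comul a)
    rw [LinearMap.convMul_apply]
    change LinearMap.mul' K A (TensorProduct.map S _ _) = _
    rw [h _ (le_max_right (N a) N'), ← LinearMap.convMul_apply, hG]
    dsimp only
    rw [geom_sum_mul_neg]
    exact hend a _ (le_max_left _ _)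
  · ext a
    obtain ⟨N', h⟩ := htr (1 - J).ofConv (comul a)
    rw [LinearMap.convMul_apply]
    change LinearMap.mul' K A (TensorProduct.map _ S _) = _
    rw [h _ (le_max_right (N a) N'), ← LinearMap.convMul_apply, hG]
    dsimp only
    rw [mul_neg_geom_sum]
    exact hend a _ (le_max_left _ _)

/-- Write the identity as `1 - J` with `J = 1 - id`; connectedness makes `J` vanish in degree `0`,
so its powers are locally zero. No compatibility between product and coproduct is needed. -/
theorem exists_antipode_of_connected [Ring A] [Algebra K A] [Coalgebra K A] (𝒜 : ℕ → Submodule K A)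
    (htop : ⨆ n, 𝒜 n = ⊤)
    (hcomul : ∀ n, ∀ a ∈ 𝒜 n, comul (R := K) a ∈ ⨆ p ∈ Finset.HasAntidiagonal.antidiagonal n,
      LinearMap.range (TensorProduct.mapIncl (𝒜 p.1) (𝒜 p.2)))
    (h0 : ∀ a ∈ 𝒜 0, a = algebraMap K A (counit a)) :
    ∃ S : WithConv (A →ₗ[K] A), S * toConv LinearMap.id = 1 ∧ toConv LinearMap.id * S = 1 := by
  have key := exists_conv_inverse_one_sub (1 - toConv (LinearMap.id : A →ₗ[K] A)) ?_
  · simpa using key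
  intro a
  have ha : a ∈ ⨆ n, 𝒜 n := htop ▸ Submodule.mem_top
  have hJ : ∀ a ∈ 𝒜 0, (1 - toConv (LinearMap.id : A →ₗ[K] A)) a = 0 := by
    intro a ha
    have := h0 a ha
    simp only [WithConv.ofConv_sub, LinearMap.sub_apply, LinearMap.convOne_apply,
      LinearMap.id_apply]
    rw [← this, sub_self]
  induction ha using Submodule.iSup_induction' with
  | mem i x hx => exact ⟨i + 1, fun n hn => convPow_eq_zero_of_mem 𝒜 hcomul _ hJ n i hn x hx⟩
  | zero => exact ⟨0, by simp⟩
  | add x y _ _ hx hy =>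
    obtain ⟨a, ha⟩ := hx
    obtain ⟨b, hb⟩ := hy
    exact ⟨max a b, fun n hn => by
      rw [map_add, ha n (le_trans (le_max_left _ _) hn),
        hb n (le_trans (le_max_right _ _) hn), add_zero]⟩

/-- Morphisms of bialgebras between Hopf algebras commute with the antipodes. -/
theorem BialgHom.map_antipode {H W : Type*} [Ring H] [HopfAlgebra K H] [Ring W] [HopfAlgebra K W]
    (f : H →ₐc[K] W) (x : H) :
    f (HopfAlgebra.antipode K x) = HopfAlgebra.antipode K (f x) := by
  set F : H →ₗ[K] W := (f : H →ₐ[K] W).toLinearMap with hF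
  -- Composing with the antipode of `H` gives a left convolution inverse of `F`, composing with that
  -- of `W` a right one; the two coincide.
  have h₁ : toConv (F ∘ₗ HopfAlgebra.antipode K) * toConv F = 1 := by
    have := LinearMap.algHom_comp_convMul_distrib (f : H →ₐ[K] W)
      (toConv (HopfAlgebra.antipode K (A := H))) (toConv LinearMap.id)
    rw [LinearMap.antipode_mul_id] at this
    ext a
    exact (LinearMap.congr_fun this a).symm.trans ((f : H →ₐ[K] W).commutes _)
  have h₂ : toConv F * toConv (HopfAlgebra.antipode K ∘ₗ F) = 1 := by
    have := LinearMap.convMul_comp_coalgHom_distrib (toConv (LinearMap.id (R := K) (M := W)))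
      (toConv (HopfAlgebra.antipode K (A := W))) (f : H →ₗc[K] W)
    rw [LinearMap.id_mul_antipode] at this
    ext a
    refine (LinearMap.congr_fun this a).symm.trans ?_
    exact congrArg (algebraMap K W) (LinearMap.congr_fun (f : H →ₗc[K] W).counit_comp a)
  have h₃ := left_inv_eq_right_inv h₁ h₂
  exact LinearMap.congr_fun (congrArg ofConv h₃) x

end Convolution

/-! ## Packing and shuffling of words -/

/-- The size of an image depends only on the fibres. -/
theorem Finset.card_image_eq_card_image {α β γ : Type*} [DecidableEq β] [DecidableEq γ]
    (s : Finset α) (f : α → β) (g : α → γ) (h : ∀ a ∈ s, ∀ b ∈ s, f a = f b ↔ g a = g b) :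
    (s.image f).card = (s.image g).card := by
  classical
  induction s using Finset.induction_on with
  | empty => simp
  | insert a s ha ih =>
    have ih' := ih fun x hx y hy => h x (Finset.mem_insert_of_mem hx) y (Finset.mem_insert_of_mem hy)
    have hiff : f a ∈ s.image f ↔ g a ∈ s.image g := by
      simp only [Finset.mem_image]
      exact exists_congr fun x => and_congr_right fun hx =>
        h x (Finset.mem_insert_of_mem hx) a (Finset.mem_insert_self a s)
    rw [Finset.image_insert, Finset.image_insert]
    by_cases hf : f a ∈ s.image f
    · rw [Finset.insert_eq_of_mem hf, Finset.insert_eq_of_mem (hiff.1 hf), ih']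
    · rw [Finset.card_insert_of_notMem hf, Finset.card_insert_of_notMem (mt hiff.2 hf), ih']

/-- A packed letter counts the distinct letters not exceeding it, so only comparisons between
letters matter. This allows ranks to be replaced by any letters in the same order. -/
theorem pack_map_congr {α : Type*} (l : List α) (f g : α → ℕ)
    (h : ∀ a ∈ l, ∀ b ∈ l, f a ≤ f b ↔ g a ≤ g b) : pack (l.map f) = pack (l.map g) := by
  classical
  rw [pack, pack, List.map_map, List.map_map]
  refine List.map_congr_left fun a ha => ?_
  have aux : ∀ k : α → ℕ, (l.map k).toFinset.filter (· ≤ k a)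
      = (l.toFinset.filter fun b => k b ≤ k a).image k := by
    intro k
    ext x
    simp only [Finset.mem_filter, List.mem_toFinset, List.mem_map, Finset.mem_image]
    constructor
    · rintro ⟨⟨b, hb, rfl⟩, h'⟩
      exact ⟨b, ⟨hb, h'⟩, rfl⟩
    · rintro ⟨b, ⟨hb, h'⟩, rfl⟩
      exact ⟨⟨b, hb, rfl⟩, h'⟩
  simp only [Function.comp_apply]
  rw [aux, aux, Finset.filter_congr (q := fun b => g b ≤ g a)
    fun b hb => h b (List.mem_toFinset.1 hb) a ha]
  refine Finset.card_image_eq_card_image _ _ _ fun b hb c hc => ?_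
  have hb' := List.mem_toFinset.1 (Finset.mem_filter.1 hb).1
  have hc' := List.mem_toFinset.1 (Finset.mem_filter.1 hc).1
  rw [le_antisymm_iff, le_antisymm_iff, h b hb' c hc', h c hc' b hb']

theorem card_filter_le_le_iff (w : List ℕ) {a b : ℕ} (ha : a ∈ w) :
    (w.toFinset.filter (· ≤ a)).card ≤ (w.toFinset.filter (· ≤ b)).card ↔ a ≤ b := by
  constructor
  · intro h
    by_contra hab
    refine h.not_gt (Finset.card_lt_card (Finset.ssubset_iff_of_subset ?_ |>.2 ⟨a, ?_, ?_⟩))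
    · intro x hx
      simp only [Finset.mem_filter] at hx ⊢
      exact ⟨hx.1, by omega⟩
    · simp [ha]
    · simp only [Finset.mem_filter, not_and]
      exact fun _ => hab
  · intro hab
    refine Finset.card_le_card fun x hx => ?_
    simp only [Finset.mem_filter] at hx ⊢
    exact ⟨hx.1, hx.2.trans hab⟩

/-- Packing a sublist of a packed list does the same as packing the sublist. -/
theorem pack_map_card_filter (w u : List ℕ) (h : u ⊆ w) :
    pack (u.map fun a => (w.toFinset.filter (· ≤ a)).card) = pack u := by
  conv_rhs => rw [← List.map_id u]
  exact pack_map_congr u _ _ fun a ha b _ => card_filter_le_le_iff w (h ha)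

/-- Packing preserves the order of letters, so doing it before the cut changes nothing once the part
is packed. -/
theorem pack_take_pack (w : List ℕ) (k : ℕ) : pack ((pack w).take k) = pack (w.take k) := by
  rw [show pack w = w.map fun a => (w.toFinset.filter (· ≤ a)).card from rfl, ← List.map_take]
  exact pack_map_card_filter w _ (List.take_subset k w)

theorem pack_drop_pack (w : List ℕ) (k : ℕ) : pack ((pack w).drop k) = pack (w.drop k) := by
  rw [show pack w = w.map fun a => (w.toFinset.filter (· ≤ a)).card from rfl, ← List.map_drop]
  exact pack_map_card_filter w _ (List.drop_subset k w)

@[simp]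
theorem length_pack (w : List ℕ) : (pack w).length = w.length := by simp [pack]

theorem PackedWord.ext_word {σ τ : PackedWord} (h : σ.word = τ.word) : σ = τ := by
  cases σ; cases τ; cases h; rfl

theorem pack_word (τ : PackedWord) : pack τ.word = τ.word := by
  obtain ⟨w, k, hk⟩ := τ
  refine Eq.trans ?_ (List.map_id w)
  refine List.map_congr_left fun a ha => ?_
  have : w.toFinset.filter (· ≤ a) = Finset.Icc 1 a := by
    ext x
    have := (hk a).1 ha
    simp only [Finset.mem_filter, List.mem_toFinset, hk, Finset.mem_Icc]
    omega
  rw [this]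
  simp

@[simp]
theorem packWord_word (τ : PackedWord) : packWord τ.word = τ := PackedWord.ext_word (pack_word τ)

theorem packWord_eq_packWord {u v : List ℕ} (h : pack u = pack v) : packWord u = packWord v :=
  PackedWord.ext_word h

theorem packWord_map_congr {α : Type*} (l : List α) (f g : α → ℕ)
    (h : ∀ a ∈ l, ∀ b ∈ l, f a ≤ f b ↔ g a ≤ g b) : packWord (l.map f) = packWord (l.map g) :=
  packWord_eq_packWord (pack_map_congr l f g h)

theorem packWord_eq_empty_iff (w : List ℕ) : packWord w = PackedWord.empty ↔ w = [] := by
  constructor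
  · intro h
    have := congrArg (fun τ : PackedWord => τ.word.length) h
    simpa [packWord, PackedWord.empty] using this
  · rintro rfl
    exact PackedWord.ext_word rfl

theorem PackedWord.le_max (τ : PackedWord) {a : ℕ} (ha : a ∈ τ.word) : a ≤ τ.max := by
  have : ∀ (l : List ℕ), a ∈ l → a ≤ l.foldr Max.max 0 := by
    intro l
    induction l with
    | nil => simp
    | cons b l ih =>
      intro h
      rw [List.foldr_cons, le_max_iff]
      rcases List.mem_cons.1 h with rfl | h
      · exact Or.inl le_rfl
      · exact Or.inr (ih h)
  exact this _ ha

/-- The shufflings of two lists, the letters remembering the list they come from. -/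
def sumShuffles {α β : Type*} : List α → List β → List (List (α ⊕ β))
  | [], v => [v.map Sum.inr]
  | u, [] => [u.map Sum.inl]
  | a :: u, b :: v =>
    (sumShuffles u (b :: v)).map (Sum.inl a :: ·) ++ (sumShuffles (a :: u) v).map (Sum.inr b :: ·)
termination_by u v => u.length + v.length

section sumShuffles

variable {α β : Type*}

@[simp]
theorem sumShuffles_nil_left (v : List β) :
    sumShuffles ([] : List α) v = [v.map Sum.inr] := by rw [sumShuffles]

@[simp]
theorem sumShuffles_nil_right (u : List α) :
    sumShuffles u ([] : List β) = [u.map Sum.inl] := by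
  cases u with
  | nil => simp
  | cons a u => rw [sumShuffles]; simp

theorem sumShuffles_cons_cons (a : α) (u : List α) (b : β) (v : List β) :
    sumShuffles (a :: u) (b :: v) = (sumShuffles u (b :: v)).map (Sum.inl a :: ·)
      ++ (sumShuffles (a :: u) v).map (Sum.inr b :: ·) := by rw [sumShuffles]

/-- Multiplicities among shuffled words become distinct labelled shuffles with the same image, which
turns sums over lists into sums over sets. -/
theorem shuffles_map (f : α → ℕ) (g : β → ℕ) (u : List α) (v : List β) :
    shuffles (u.map f) (v.map g) = (sumShuffles u v).map (List.map (Sum.elim f g)) := by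
  induction u, v using sumShuffles.induct with
  | case1 v => simp [shuffles]
  | case2 u hu =>
    cases u with
    | nil => simp at hu
    | cons a u => simp [shuffles]
  | case3 a u b v ih₁ ih₂ =>
    simp only [List.map_cons] at ih₁ ih₂ ⊢
    rw [shuffles, sumShuffles_cons_cons, ih₁, ih₂]
    simp [Function.comp_def]

theorem inl_cons_mem_sumShuffles {a : α} {m : List (α ⊕ β)} {u : List α} {v : List β} :
    Sum.inl a :: m ∈ sumShuffles u v ↔ ∃ u', u = a :: u' ∧ m ∈ sumShuffles u' v := by
  cases u with
  | nil => cases v <;> simp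
  | cons c u =>
    cases v with
    | nil =>
      simp only [sumShuffles_nil_right, List.map_cons, List.mem_singleton, List.cons.injEq,
        Sum.inl.injEq]
      constructor
      · rintro ⟨rfl, rfl⟩; exact ⟨u, ⟨rfl, rfl⟩, rfl⟩
      · rintro ⟨u', ⟨rfl, rfl⟩, rfl⟩; exact ⟨rfl, rfl⟩
    | cons b v =>
      rw [sumShuffles_cons_cons]
      simp only [List.mem_append, List.mem_map, List.cons.injEq, Sum.inl.injEq, reduceCtorEq,
        false_and, and_false, exists_false, or_false]
      constructor
      · rintro ⟨m', h, rfl, rfl⟩; exact ⟨u, ⟨rfl, rfl⟩, h⟩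
      · rintro ⟨u', ⟨rfl, rfl⟩, h⟩; exact ⟨m, h, rfl, rfl⟩

theorem inr_cons_mem_sumShuffles {b : β} {m : List (α ⊕ β)} {u : List α} {v : List β} :
    Sum.inr b :: m ∈ sumShuffles u v ↔ ∃ v', v = b :: v' ∧ m ∈ sumShuffles u v' := by
  cases v with
  | nil => cases u <;> simp
  | cons c v =>
    cases u with
    | nil =>
      simp only [sumShuffles_nil_left, List.map_cons, List.mem_singleton, List.cons.injEq,
        Sum.inr.injEq]
      constructor
      · rintro ⟨rfl, rfl⟩; exact ⟨v, ⟨rfl, rfl⟩, rfl⟩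
      · rintro ⟨u', ⟨rfl, rfl⟩, rfl⟩; exact ⟨rfl, rfl⟩
    | cons a u =>
      rw [sumShuffles_cons_cons]
      simp only [List.mem_append, List.mem_map, List.cons.injEq, Sum.inr.injEq, reduceCtorEq,
        false_and, and_false, exists_false, false_or]
      constructor
      · rintro ⟨m', h, rfl, rfl⟩; exact ⟨v, ⟨rfl, rfl⟩, h⟩
      · rintro ⟨u', ⟨rfl, rfl⟩, h⟩; exact ⟨m, h, rfl, rfl⟩

theorem nil_mem_sumShuffles {u : List α} {v : List β} :
    [] ∈ sumShuffles u v ↔ u = [] ∧ v = [] := by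
  cases u <;> cases v <;> simp [sumShuffles_cons_cons]

/-- The label of the first letter tells which list it was taken from, so letters can be peeled off
without ambiguity. -/
theorem mem_sumShuffles {m : List (α ⊕ β)} {u : List α} {v : List β} :
    m ∈ sumShuffles u v ↔ m.filterMap Sum.getLeft? = u ∧ m.filterMap Sum.getRight? = v := by
  induction m generalizing u v with
  | nil => rw [nil_mem_sumShuffles]; simp [eq_comm]
  | cons x m ih =>
    rcases x with a | b
    · rw [inl_cons_mem_sumShuffles]
      simp only [ih]
      constructor
      · rintro ⟨u', rfl, rfl, rfl⟩; exact ⟨rfl, rfl⟩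
      · rintro ⟨rfl, rfl⟩; exact ⟨_, rfl, rfl, rfl⟩
    · rw [inr_cons_mem_sumShuffles]
      simp only [ih]
      constructor
      · rintro ⟨u', rfl, rfl, rfl⟩; exact ⟨rfl, rfl⟩
      · rintro ⟨rfl, rfl⟩; exact ⟨_, rfl, rfl, rfl⟩

theorem nodup_sumShuffles (u : List α) (v : List β) : (sumShuffles u v).Nodup := by
  induction u, v using sumShuffles.induct with
  | case1 v => simp
  | case2 u hu => simp
  | case3 a u b v ih₁ ih₂ =>
    rw [sumShuffles_cons_cons, List.nodup_append']
    refine ⟨ih₁.map (List.cons_injective), ih₂.map (List.cons_injective), ?_⟩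
    intro m h h'
    simp only [List.mem_map] at h h'
    obtain ⟨_, _, rfl⟩ := h
    obtain ⟨_, _, h⟩ := h'
    simp at h

end sumShuffles

/-! ## Linear extensions and cuts of preordered forests -/

namespace PreForest

theorem reach_antisymm {F : PreForest} {a b : F.V} (h : F.reach a b) (h' : F.reach b a) : a = b := by
  rcases Relation.reflTransGen_iff_eq_or_transGen.1 h with h | h
  · exact h.symm
  · exact (F.acyclic a (h.trans_left h')).elim

/-- If `v` is not below `w`, then `w` is below `v`, and the class of `v` is counted in the rank of
`v` but not in that of `w`. -/
theorem rank_le_rank_iff (F : PreForest) (v w : F.V) : F.rank v ≤ F.rank w ↔ F.le v w := by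
  have hmono : ∀ v w, F.le v w → F.eqClass '' {u | F.le u v} ⊆ F.eqClass '' {u | F.le u w} :=
    fun v w h => Set.image_mono fun u hu => F.le_trans hu h
  constructor
  · intro h
    by_contra hvw
    refine h.not_gt (Set.ncard_lt_ncard ⟨hmono _ _ ((F.le_total v w).resolve_left hvw), fun hs => ?_⟩
      (Set.toFinite _))
    obtain ⟨u, hu, huv⟩ := hs ⟨v, F.le_refl v, rfl⟩
    have hv : v ∈ F.eqClass u := huv ▸ ⟨F.le_refl v, F.le_refl v⟩
    exact hvw (F.le_trans hv.1 hu)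
  · exact fun h => Set.ncard_le_ncard (hmono v w h) (Set.toFinite _)

theorem rank_pos (F : PreForest) (v : F.V) : 0 < F.rank v :=
  (Set.ncard_pos (Set.toFinite _)).2 ⟨_, v, F.le_refl v, rfl⟩

theorem rank_eq_rank_iff (F : PreForest) (v w : F.V) :
    F.rank v = F.rank w ↔ F.eqClass v = F.eqClass w := by
  rw [le_antisymm_iff, rank_le_rank_iff, rank_le_rank_iff]
  constructor
  · rintro ⟨h, h'⟩
    ext x
    exact ⟨fun hx => ⟨F.le_trans hx.1 h, F.le_trans h' hx.2⟩,
      fun hx => ⟨F.le_trans hx.1 h', F.le_trans h hx.2⟩⟩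
  · intro h
    have : v ∈ F.eqClass w := h ▸ ⟨F.le_refl v, F.le_refl v⟩
    exact this

/-- Ranks separate exactly the equivalence classes, so the number of ranks up to that of `v` is
again the rank of `v`: rank words are already packed. -/
theorem pack_map_rank (F : PreForest) (l : List F.V) (hl : ∀ v, v ∈ l) :
    pack (l.map F.rank) = l.map F.rank := by
  classical
  have := Fintype.ofFinite F.V
  rw [pack, List.map_map]
  refine List.map_congr_left fun v _ => ?_
  have h₁ : (l.map F.rank).toFinset.filter (· ≤ F.rank v)
      = (Finset.univ.filter fun u => F.le u v).image F.rank := by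
    ext x
    simp only [Finset.mem_filter, List.mem_toFinset, List.mem_map, Finset.mem_image,
      Finset.mem_univ, true_and, ← F.rank_le_rank_iff]
    constructor
    · rintro ⟨⟨b, hb, rfl⟩, h'⟩
      exact ⟨b, h', rfl⟩
    · rintro ⟨b, h', rfl⟩
      exact ⟨⟨b, hl b, rfl⟩, h'⟩
  have h₂ : F.rank v = ((Finset.univ.filter fun u => F.le u v).image F.eqClass).card := by
    rw [rank, ← Set.ncard_coe_finset]
    congr 1
    simp
  rw [Function.comp_apply, h₁]
  rw [h₂]
  exact Finset.card_image_eq_card_image _ _ _ fun a _ b _ => F.rank_eq_rank_iff a b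

/-- The linear extensions of a forest, as lists of its vertices: the descendants of a vertex are
written before it. -/
abbrev LinExt (F : PreForest) : Type :=
  {l : List F.V // (∀ v, v ∈ l) ∧ l.Pairwise fun a b => ¬ F.reach b a}

theorem LinExt.nodup {F : PreForest} (l : F.LinExt) : l.1.Nodup :=
  l.2.2.imp fun {a b} h => by
    rintro rfl
    exact h .refl

noncomputable instance (F : PreForest) : Fintype F.LinExt :=
  have : Finite F.LinExt := by
    classical
    have := Fintype.ofFinite F.V
    exact Finite.of_injective (β := {l : List F.V // l.Nodup}) (fun l => ⟨l.1, l.nodup⟩)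
      fun l l' h => Subtype.ext (by simpa using h)
  Fintype.ofFinite _

theorem LinExt.length_eq {F : PreForest} (l : F.LinExt) : l.1.length = F.degree := by
  classical
  rw [degree, Nat.card_congr (List.Nodup.getEquivOfForallMemList l.1 l.nodup l.2.1).symm]
  simp

/-- The word that reads the ranks of the vertices along a linear extension. -/
noncomputable def LinExt.packedWord {F : PreForest} (l : F.LinExt) : PackedWord :=
  packWord (l.1.map F.rank)

theorem LinExt.word_packedWord {F : PreForest} (l : F.LinExt) :
    l.packedWord.word = l.1.map F.rank := F.pack_map_rank l.1 l.2.1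

/-- The linear extension attached to a bijection in `F.linearizations τ`. -/
def linExtOfMem {F : PreForest} {τ : PackedWord} (φ : F.linearizations τ) : F.LinExt :=
  ⟨List.ofFn φ.1.symm, fun v => List.mem_ofFn.2 ⟨φ.1 v, by simp⟩, by
    rw [List.pairwise_ofFn]
    intro i j hij h
    have := φ.2.2 _ _ h
    simp only [Equiv.apply_symm_apply] at this
    exact this.not_gt hij⟩

theorem packedWord_linExtOfMem {F : PreForest} {τ : PackedWord} (φ : F.linearizations τ) :
    (linExtOfMem φ).packedWord = τ := by
  refine PackedWord.ext_word ?_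
  rw [LinExt.word_packedWord]
  refine List.ext_getElem (by simp [linExtOfMem]) fun i h₁ h₂ => ?_
  simp [linExtOfMem, φ.2.1]

/-- A bijection corresponds to the list of values of its inverse, and a linear extension to the map
sending a vertex to its position. The rank condition says that the word read is `τ`. -/
theorem card_linearizations_eq (F : PreForest) (τ : PackedWord) :
    Nat.card (F.linearizations τ) = Nat.card {l : F.LinExt // l.packedWord = τ} := by
  classical
  refine Nat.card_congr (Equiv.ofBijective
    (fun φ => ⟨linExtOfMem φ, packedWord_linExtOfMem φ⟩) ⟨?_, ?_⟩)
  · intro φ ψ h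
    have h' : List.ofFn φ.1.symm = List.ofFn ψ.1.symm :=
      congrArg (fun l : {l : F.LinExt // l.packedWord = τ} => l.1.1) h
    have h'' := List.ofFn_injective h'
    exact Subtype.ext (Equiv.symm_bijective.injective (Equiv.coe_fn_injective h''))
  · rintro ⟨l, rfl⟩
    have hw := l.word_packedWord
    have hlen : l.1.length = l.packedWord.word.length := by rw [hw, List.length_map]
    set e := (List.Nodup.getEquivOfForallMemList l.1 l.nodup l.2.1).symm with he
    have hes : ∀ i, e.symm i = l.1.get i := fun i => rfl
    refine ⟨⟨e.trans (finCongr hlen), ?_, ?_⟩, ?_⟩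
    · intro v
      obtain ⟨i, rfl⟩ := e.symm.surjective v
      have : l.packedWord.word.get (finCongr hlen i) = F.rank (l.1.get i) := by
        simp [hw]
      rw [Equiv.trans_apply, Equiv.apply_symm_apply, this, hes]
    · intro v v' h
      obtain ⟨i, rfl⟩ := e.symm.surjective v
      obtain ⟨j, rfl⟩ := e.symm.surjective v'
      have hle : j ≤ i := by
        by_contra hij
        exact List.pairwise_iff_get.1 l.2.2 i j (not_le.1 hij) h
      simpa using hle
    · refine Subtype.ext (Subtype.ext (List.ext_getElem ?_ fun i h₁ h₂ => ?_))
      · simp [linExtOfMem, hlen]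
      · simp [linExtOfMem, hes, finCongr]

/-- Linear extensions are grouped by the word they read. This removes the quantification over `τ`
from all later computations with `Phi`. -/
theorem wordSum_eq_sum (K : Type*) [Field K] (F : PreForest) :
    F.wordSum K = ∑ l : F.LinExt, WQSym.basis K l.packedWord := by
  classical
  refine (WQSym.basis K).repr.injective (Finsupp.ext fun τ => ?_)
  have h₁ : (WQSym.basis K).repr (F.wordSum K) τ = (Nat.card (F.linearizations τ) : K) := by
    simp [wordSum, Finsupp.ofSupportFinite]
  rw [h₁, card_linearizations_eq, map_sum, Finsupp.finsetSum_apply]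
  simp only [Module.Basis.repr_self, Finsupp.single_apply]
  rw [Finset.sum_boole, Nat.card_eq_fintype_card, Fintype.card_subtype]

/-! ### Products -/

theorem reach_prod_inl {F G : PreForest} {a : F.V} {y : F.V ⊕ G.V} :
    (F.prod G).reach (Sum.inl a) y ↔ ∃ b, y = Sum.inl b ∧ F.reach a b := by
  constructor
  · intro h
    induction h with
    | refl => exact ⟨a, rfl, .refl⟩
    | tail _ h ih =>
      obtain ⟨w, rfl, hw⟩ := ih
      cases h with | inl h => exact ⟨_, rfl, hw.tail h⟩
  · rintro ⟨b, rfl, h⟩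
    exact Relation.ReflTransGen.lift (p := (F.prod G).edge) Sum.inl (fun _ _ h => .inl h) _ _ h

theorem reach_prod_inr {F G : PreForest} {a : G.V} {y : F.V ⊕ G.V} :
    (F.prod G).reach (Sum.inr a) y ↔ ∃ b, y = Sum.inr b ∧ G.reach a b := by
  constructor
  · intro h
    induction h with
    | refl => exact ⟨a, rfl, .refl⟩
    | tail _ h ih =>
      obtain ⟨w, rfl, hw⟩ := ih
      cases h with | inr h => exact ⟨_, rfl, hw.tail h⟩
  · rintro ⟨b, rfl, h⟩
    exact Relation.ReflTransGen.lift (p := (F.prod G).edge) Sum.inr (fun _ _ h => .inr h) _ _ h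

/-- No path joins the two sides of a disjoint union, so only pairs of letters from the same side are
constrained. -/
theorem pairwise_prod_iff {F G : PreForest} (m : List (F.V ⊕ G.V)) :
    m.Pairwise (fun a b => ¬ (F.prod G).reach b a) ↔
      (m.filterMap Sum.getLeft?).Pairwise (fun a b => ¬ F.reach b a) ∧
      (m.filterMap Sum.getRight?).Pairwise (fun a b => ¬ G.reach b a) := by
  rw [List.pairwise_filterMap, List.pairwise_filterMap, ← List.pairwise_and_iff]
  refine List.Pairwise.iff fun {x y} => ?_
  rcases x with a | a <;> rcases y with b | b
  · have := reach_prod_inl (F := F) (G := G) (a := b) (y := Sum.inl a)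
    simp [this]
  · have := reach_prod_inr (F := F) (G := G) (a := b) (y := Sum.inl a)
    simp [this]
  · have := reach_prod_inl (F := F) (G := G) (a := b) (y := Sum.inr a)
    simp [this]
  · have := reach_prod_inr (F := F) (G := G) (a := b) (y := Sum.inr a)
    simp [this]

theorem mem_filterMap_getLeft {α β : Type*} (m : List (α ⊕ β)) (a : α) :
    a ∈ m.filterMap Sum.getLeft? ↔ Sum.inl a ∈ m := by
  simp [List.mem_filterMap, Sum.getLeft?_eq_some_iff]

theorem mem_filterMap_getRight {α β : Type*} (m : List (α ⊕ β)) (b : β) :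
    b ∈ m.filterMap Sum.getRight? ↔ Sum.inr b ∈ m := by
  simp [List.mem_filterMap, Sum.getRight?_eq_some_iff]

/-- A linear extension of `F G` restricts to linear extensions of `F` and of `G`. -/
def LinExt.split {F G : PreForest} (m : (F.prod G).LinExt) : F.LinExt × G.LinExt :=
  (⟨List.filterMap (Sum.getLeft? (α := F.V) (β := G.V)) m.1,
      fun v => (mem_filterMap_getLeft _ v).2 (m.2.1 (Sum.inl v)), ((pairwise_prod_iff m.1).1 m.2.2).1⟩,
    ⟨List.filterMap (Sum.getRight? (α := F.V) (β := G.V)) m.1,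
      fun v => (mem_filterMap_getRight _ v).2 (m.2.1 (Sum.inr v)), ((pairwise_prod_iff m.1).1 m.2.2).2⟩)

/-- The fibre of `LinExt.split` over `(u, v)` consists of the labelled shuffles of `u` and `v`, each
occurring once. -/
theorem sum_linExt_prod {M : Type*} [AddCommMonoid M] (F G : PreForest)
    (f : List (F.V ⊕ G.V) → M) :
    ∑ m : (F.prod G).LinExt, f m.1
      = ∑ u : F.LinExt, ∑ v : G.LinExt, ((sumShuffles u.1 v.1).map f).sum := by
  classical
  rw [← Fintype.sum_prod_type', ← Fintype.sum_fiberwise (LinExt.split (F := F) (G := G))]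
  refine Finset.sum_congr rfl fun p _ => ?_
  rw [← List.sum_toFinset f (nodup_sumShuffles p.1.1 p.2.1)]
  refine Finset.sum_bij (fun m _ => m.1.1)
    ?_ (fun m _ m' _ h => Subtype.ext (Subtype.ext h)) ?_ fun _ _ => rfl
  · intro m hm
    have hm' := m.2
    exact List.mem_toFinset.2 (mem_sumShuffles.2 ⟨congrArg (fun p => p.1.1) hm', congrArg (fun p => p.2.1) hm'⟩)
  · intro m hm
    obtain ⟨h₁, h₂⟩ := mem_sumShuffles.1 (List.mem_toFinset.1 hm)
    refine ⟨⟨⟨m, ?_, (pairwise_prod_iff m).2 ⟨h₁ ▸ p.1.2.2, h₂ ▸ p.2.2.2⟩⟩,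
      Prod.ext (Subtype.ext h₁) (Subtype.ext h₂)⟩, Finset.mem_univ _, rfl⟩
    rintro (v | v)
    · exact (mem_filterMap_getLeft m v).1 (h₁ ▸ p.1.2.1 v)
    · exact (mem_filterMap_getRight m v).1 (h₂ ▸ p.2.2.1 v)

/-- Ranks are positive, so a shift by any bound `N` puts the letters of `G` strictly above those of
`F`; after packing the exact shift is irrelevant. -/
theorem packWord_map_rank_prod {F G : PreForest} (m : List (F.V ⊕ G.V)) (N : ℕ)
    (hN : ∀ v, F.rank v ≤ N) :
    packWord (m.map (F.prod G).rank) = packWord (m.map (Sum.elim F.rank fun v => G.rank v + N)) := by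
  refine packWord_map_congr m _ _ fun x _ y _ => ((F.prod G).rank_le_rank_iff x y).trans ?_
  rcases x with a | a <;> rcases y with b | b
  · exact Sum.lex_inl_inl.trans (F.rank_le_rank_iff a b).symm
  · refine iff_of_true (Sum.Lex.sep _ _) ?_
    simp only [Sum.elim_inl, Sum.elim_inr]
    exact (hN a).trans (Nat.le_add_left _ _)
  · refine iff_of_false Sum.lex_inr_inl ?_
    have := hN b
    have := G.rank_pos a
    simp only [Sum.elim_inl, Sum.elim_inr]
    omega
  · refine Sum.lex_inr_inr.trans ((G.rank_le_rank_iff a b).symm.trans ?_)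
    simp

/-- The isomorphism between an induced subforest of `F G` and the product of the induced
subforests. -/
theorem restrict_prod_equiv (F G : PreForest) (s : Set (F.V ⊕ G.V)) (t : Set F.V) (u : Set G.V)
    (ht : ∀ a, a ∈ t ↔ Sum.inl a ∈ s) (hu : ∀ a, a ∈ u ↔ Sum.inr a ∈ s) :
    (F.restrict t).prod (G.restrict u) ≈ (F.prod G).restrict s := by
  let f : t ⊕ u → s := Sum.elim (fun a => ⟨Sum.inl a.1, (ht _).1 a.2⟩)
    (fun a => ⟨Sum.inr a.1, (hu _).1 a.2⟩)
  have hf : Function.Bijective f := by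
    constructor
    · rintro (a | a) (b | b) h
      · have := congrArg Subtype.val h
        simp only [f, Sum.elim_inl, Sum.inl.injEq] at this
        rw [Subtype.ext this]
      · have := congrArg Subtype.val h
        simp [f] at this
      · have := congrArg Subtype.val h
        simp [f] at this
      · have := congrArg Subtype.val h
        simp only [f, Sum.elim_inr, Sum.inr.injEq] at this
        rw [Subtype.ext this]
    · rintro ⟨a | a, h⟩
      · exact ⟨Sum.inl ⟨a, (ht a).2 h⟩, rfl⟩
      · exact ⟨Sum.inr ⟨a, (hu a).2 h⟩, rfl⟩
  refine ⟨⟨Equiv.ofBijective f hf, ?_, ?_⟩⟩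
  · rintro (v | v) (w | w)
    · exact (Sum.liftRel_inl_inl (r := F.edge) (s := G.edge)).trans
        (Sum.liftRel_inl_inl (r := (F.restrict t).edge) (s := (G.restrict u).edge)).symm
    · exact iff_of_false Sum.not_liftRel_inl_inr Sum.not_liftRel_inl_inr
    · exact iff_of_false Sum.not_liftRel_inr_inl Sum.not_liftRel_inr_inl
    · exact (Sum.liftRel_inr_inr (r := F.edge) (s := G.edge)).trans
        (Sum.liftRel_inr_inr (r := (F.restrict t).edge) (s := (G.restrict u).edge)).symm
  · rintro (v | v) (w | w)
    · exact (Sum.lex_inl_inl (r := F.le) (s := G.le)).trans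
        (Sum.lex_inl_inl (r := (F.restrict t).le) (s := (G.restrict u).le)).symm
    · exact iff_of_true (Sum.Lex.sep _ _) (Sum.Lex.sep _ _)
    · exact iff_of_false Sum.lex_inr_inl Sum.lex_inr_inl
    · exact (Sum.lex_inr_inr (r := F.le) (s := G.le)).trans
        (Sum.lex_inr_inr (r := (F.restrict t).le) (s := (G.restrict u).le)).symm

/-- The admissible cuts of `F G`. -/
def cutProdEquiv (F G : PreForest) : F.Cut × G.Cut ≃ (F.prod G).Cut where
  toFun p := ⟨fun x : F.V ⊕ G.V => Sum.elim (· ∈ p.1.1) (· ∈ p.2.1) x, by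
    rintro (a | a) ha b hb hab h
    · obtain ⟨b, rfl, h'⟩ := reach_prod_inl.1 h
      exact p.1.2 a ha b hb (fun hh => hab (by rw [hh])) h'
    · obtain ⟨b, rfl, h'⟩ := reach_prod_inr.1 h
      exact p.2.2 a ha b hb (fun hh => hab (by rw [hh])) h'⟩
  invFun v := (⟨fun a => (Sum.inl a : F.V ⊕ G.V) ∈ v.1, fun a ha b hb hab h =>
      v.2 _ ha _ hb (fun hh => hab (Sum.inl_injective hh)) (reach_prod_inl.2 ⟨b, rfl, h⟩)⟩,
    ⟨fun a => (Sum.inr a : F.V ⊕ G.V) ∈ v.1, fun a ha b hb hab h =>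
      v.2 _ ha _ hb (fun hh => hab (Sum.inr_injective hh)) (reach_prod_inr.2 ⟨b, rfl, h⟩)⟩)
  left_inv _ := rfl
  right_inv v := by
    refine Subtype.ext (Set.ext fun x => ?_)
    rcases x with a | a <;> exact Iff.rfl

theorem inl_mem_leaSet_iff {F G : PreForest} (p : F.Cut × G.Cut) (a : F.V) :
    a ∈ F.leaSet p.1 ↔ (Sum.inl a : F.V ⊕ G.V) ∈ (F.prod G).leaSet (cutProdEquiv F G p) := by
  constructor
  · rintro ⟨x, hx, h⟩
    exact ⟨Sum.inl x, hx, reach_prod_inl.2 ⟨x, rfl, h⟩⟩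
  · rintro ⟨x, hx, h⟩
    obtain ⟨b, rfl, h'⟩ := reach_prod_inl.1 h
    exact ⟨b, hx, h'⟩

theorem inr_mem_leaSet_iff {F G : PreForest} (p : F.Cut × G.Cut) (a : G.V) :
    a ∈ G.leaSet p.2 ↔ (Sum.inr a : F.V ⊕ G.V) ∈ (F.prod G).leaSet (cutProdEquiv F G p) := by
  constructor
  · rintro ⟨x, hx, h⟩
    exact ⟨Sum.inr x, hx, reach_prod_inr.2 ⟨x, rfl, h⟩⟩
  · rintro ⟨x, hx, h⟩
    obtain ⟨b, rfl, h'⟩ := reach_prod_inr.1 h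
    exact ⟨b, hx, h'⟩

/-! ### Cuts -/

/-- An antichain is the set of maximal elements of the set it generates: an element of `v` leads to
one of `w`, which leads back to one of `v`, and the antichain condition closes the loop. -/
theorem leaSet_injective (F : PreForest) : Function.Injective F.leaSet := by
  have key : ∀ v w : F.Cut, F.leaSet v = F.leaSet w → v.1 ⊆ w.1 := by
    intro v w h a ha
    have h₁ : a ∈ F.leaSet w := h ▸ ⟨a, ha, .refl⟩
    obtain ⟨x, hx, hax⟩ := h₁
    have h₂ : x ∈ F.leaSet v := h ▸ ⟨x, hx, .refl⟩
    obtain ⟨y, hy, hxy⟩ := h₂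
    have hay : a = y := by
      by_contra hne
      exact v.2 a ha y hy hne (hax.trans hxy)
    subst hay
    rwa [reach_antisymm hax hxy]
  exact fun v w h => Subtype.ext (Set.Subset.antisymm (key v w h) (key w v h.symm))

theorem exists_leaSet_eq (F : PreForest) (s : Set F.V)
    (hs : ∀ x ∈ s, ∀ y, F.reach y x → y ∈ s) : ∃ v : F.Cut, F.leaSet v = s := by
  -- For the order given by paths, roots are maximal; the required cut consists of the maximal
  -- elements of `s`.
  let _ : PartialOrder F.V :=
    { le := F.reach
      le_refl := fun _ => .refl
      le_trans := fun _ _ _ h h' => h.trans h'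
      le_antisymm := fun _ _ => reach_antisymm }
  refine ⟨⟨{x | Maximal (· ∈ s) x}, fun a ha b hb hab h => hab (ha.eq_of_le hb.1 h)⟩, ?_⟩
  ext w
  constructor
  · rintro ⟨x, hx, h⟩
    exact hs x hx.1 w h
  · intro hw
    obtain ⟨b, hb, hmax⟩ := (Set.toFinite s).exists_le_maximal hw
    exact ⟨b, hmax, hb⟩

theorem mem_leaSet_of_reach {F : PreForest} {v : F.Cut} {x y : F.V} (hx : x ∈ F.leaSet v)
    (h : F.reach y x) : y ∈ F.leaSet v := by
  obtain ⟨z, hz, hxz⟩ := hx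
  exact ⟨z, hz, h.trans hxz⟩

end PreForest

/-! ### Cutting linear extensions -/

namespace PreForest

/-- The inclusion of the vertices of an induced subforest. -/
def incl (F : PreForest) (s : Set F.V) (v : (F.restrict s).V) : F.V := Subtype.val v

theorem incl_injective (F : PreForest) (s : Set F.V) : Function.Injective (F.incl s) :=
  Subtype.val_injective

theorem incl_mem (F : PreForest) (s : Set F.V) (v : (F.restrict s).V) : F.incl s v ∈ s :=
  Subtype.property v

/-- The hypothesis is convexity of `s` between the endpoints; it keeps the whole path inside `s`. -/
theorem reach_restrict {F : PreForest} {s : Set F.V} {a b : (F.restrict s).V}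
    (hs : ∀ z, F.reach (F.incl s a) z → F.reach z (F.incl s b) → z ∈ s)
    (h : F.reach (F.incl s a) (F.incl s b)) : (F.restrict s).reach a b := by
  obtain ⟨b, hb⟩ := b
  obtain ⟨a, ha⟩ := a
  change Relation.ReflTransGen F.edge a b at h
  induction h using Relation.ReflTransGen.head_induction_on with
  | refl => exact .refl
  | @head a c hac hcb ih =>
    have hc : c ∈ s := hs c (.single hac) hcb
    have hedge : (F.restrict s).edge ⟨a, ha⟩ ⟨c, hc⟩ := hac
    exact Relation.ReflTransGen.head hedge
      (ih hc fun z hz hzb => hs z (.head hac hz) hzb)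

/-- The concatenation of linear extensions of the parts above and below a cut. -/
def LinExt.append {F : PreForest} {v : F.Cut} (l₁ : (F.restrict (F.leaSet v)).LinExt)
    (l₂ : (F.restrict (F.leaSet v)ᶜ).LinExt) : F.LinExt := by
  refine ⟨l₁.1.map (F.incl _) ++ l₂.1.map (F.incl _), fun x => ?_, ?_⟩
  · rw [List.mem_append]
    by_cases hx : x ∈ F.leaSet v
    · exact Or.inl (List.mem_map.2 ⟨⟨x, hx⟩, l₁.2.1 _, rfl⟩)
    · exact Or.inr (List.mem_map.2 ⟨⟨x, hx⟩, l₂.2.1 _, rfl⟩)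
  · rw [List.pairwise_append, List.pairwise_map, List.pairwise_map]
    refine ⟨?_, ?_, ?_⟩
    · refine l₁.2.2.imp fun {a b} hab h => hab (reach_restrict (fun z _ hz => ?_) h)
      exact mem_leaSet_of_reach (F.incl_mem _ a) hz
    · refine l₂.2.2.imp fun {a b} hab h => hab (reach_restrict (fun z hz _ hz' => ?_) h)
      exact F.incl_mem _ b (mem_leaSet_of_reach hz' hz)
    · intro a ha b hb h
      obtain ⟨a, _, rfl⟩ := List.mem_map.1 ha
      obtain ⟨b, _, rfl⟩ := List.mem_map.1 hb
      exact F.incl_mem _ b (mem_leaSet_of_reach (F.incl_mem _ a) h)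

theorem LinExt.exists_restrict {F : PreForest} {s : Set F.V} {l : List F.V}
    (hl : l.Pairwise fun a b => ¬ F.reach b a) (hs : ∀ x, x ∈ s ↔ x ∈ l) :
    ∃ l' : (F.restrict s).LinExt, l'.1.map (F.incl s) = l := by
  obtain ⟨l', rfl⟩ : ∃ l' : List (F.restrict s).V, l'.map (F.incl s) = l :=
    ⟨l.attachWith (· ∈ s) fun x hx => (hs x).2 hx, List.attachWith_map_subtype_val ..⟩
  refine ⟨⟨l', fun x => ?_, ?_⟩, rfl⟩
  · exact (List.mem_map_of_injective (F.incl_injective s)).1 ((hs _).1 (F.incl_mem s x))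
  · rw [List.pairwise_map] at hl
    exact hl.imp fun {a b} h h' => h (PreForest.restrict_reach h')

/-- A prefix of a linear extension is closed under descendants, hence is the part above an
admissible cut. -/
theorem LinExt.exists_append_eq {F : PreForest} (l : F.LinExt) (k : ℕ) :
    ∃ (v : F.Cut) (l₁ : (F.restrict (F.leaSet v)).LinExt) (l₂ : (F.restrict (F.leaSet v)ᶜ).LinExt),
      l₁.1.map (F.incl _) = l.1.take k ∧ l₂.1.map (F.incl _) = l.1.drop k := by
  have hl := l.2.2
  rw [← List.take_append_drop k l.1, List.pairwise_append] at hl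
  obtain ⟨hp₁, hp₂, hp⟩ := hl
  have hmem : ∀ x, x ∈ l.1.take k ∨ x ∈ l.1.drop k := fun x => by
    rw [← List.mem_append, List.take_append_drop]
    exact l.2.1 x
  have hdisj : ∀ x, x ∈ l.1.take k → x ∉ l.1.drop k := fun x h h' => hp x h x h' .refl
  obtain ⟨v, hv⟩ := F.exists_leaSet_eq {x | x ∈ l.1.take k}
    fun x hx y hyx => (hmem y).resolve_right fun hy => hp x hx y hy hyx
  have h₁ : ∀ x, x ∈ F.leaSet v ↔ x ∈ l.1.take k := fun x => by rw [hv]; exact Iff.rfl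
  have h₂ : ∀ x, x ∈ (F.leaSet v)ᶜ ↔ x ∈ l.1.drop k := fun x => by
    rw [Set.mem_compl_iff, h₁]
    exact ⟨(hmem x).resolve_left, fun h h' => hdisj x h' h⟩
  obtain ⟨l₁, e₁⟩ := LinExt.exists_restrict hp₁ h₁
  obtain ⟨l₂, e₂⟩ := LinExt.exists_restrict hp₂ h₂
  exact ⟨v, l₁, l₂, e₁, e₂⟩

/-- Concatenation with the length of the first factor is a bijection from triples `(v, l₁, l₂)` to
pairs `(l, k)`. The left side models the cut coproduct, the right side deconcatenation. -/
theorem sum_cut_linExt {M : Type*} [AddCommMonoid M] (F : PreForest)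
    (f : List F.V → List F.V → M) :
    ∑ v : F.Cut, ∑ l₁ : (F.restrict (F.leaSet v)).LinExt, ∑ l₂ : (F.restrict (F.leaSet v)ᶜ).LinExt,
        f (l₁.1.map (F.incl _)) (l₂.1.map (F.incl _))
      = ∑ l : F.LinExt, ∑ k ∈ Finset.range (F.degree + 1), f (l.1.take k) (l.1.drop k) := by
  simp_rw [← Fintype.sum_prod_type']
  rw [Finset.sum_sigma', Finset.sum_sigma']
  refine Finset.sum_bij
    (fun x _ => ⟨LinExt.append x.2.1 x.2.2, x.2.1.1.length⟩) ?_ ?_ ?_ ?_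
  · rintro ⟨v, l₁, l₂⟩ _
    rw [Finset.mem_sigma]
    refine ⟨Finset.mem_univ _, Finset.mem_range_succ_iff.2 ?_⟩
    rw [← (LinExt.append l₁ l₂).length_eq]
    simp [LinExt.append]
  · rintro ⟨v, l₁, l₂⟩ _ ⟨w, m₁, m₂⟩ _ h
    rw [Sigma.mk.injEq] at h
    obtain ⟨h, hlen⟩ := h
    have h' := List.append_inj (congrArg Subtype.val h) (by simpa using hlen)
    dsimp only at h'
    -- Equal prefixes list the same vertices above the two cuts, and that set determines the cut.
    have hvw : v = w := by
      refine F.leaSet_injective (Set.ext fun x => ?_)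
      have aux : ∀ {v : F.Cut} (l : (F.restrict (F.leaSet v)).LinExt),
          x ∈ F.leaSet v ↔ x ∈ l.1.map (F.incl _) := fun {v} l =>
        ⟨fun hx => List.mem_map.2 ⟨⟨x, hx⟩, l.2.1 _, rfl⟩, fun hx => by
          obtain ⟨y, _, rfl⟩ := List.mem_map.1 hx
          exact F.incl_mem _ y⟩
      rw [aux l₁, aux m₁, h'.1]
    subst hvw
    have h₁ : l₁ = m₁ := Subtype.ext (List.map_injective_iff.2 (F.incl_injective _) h'.1)
    have h₂ : l₂ = m₂ := Subtype.ext (List.map_injective_iff.2 (F.incl_injective _) h'.2)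
    rw [h₁, h₂]
  · rintro ⟨l, k⟩ hk
    obtain ⟨v, l₁, l₂, h₁, h₂⟩ := l.exists_append_eq k
    have hk' := Finset.mem_range_succ_iff.1 (Finset.mem_sigma.1 hk).2
    refine ⟨⟨v, l₁, l₂⟩, by simp, ?_⟩
    rw [Sigma.mk.injEq]
    refine ⟨Subtype.ext ?_, heq_of_eq ?_⟩
    · simp only [LinExt.append, h₁, h₂, List.take_append_drop]
    · have := congrArg List.length h₁
      rw [List.length_map, List.length_take, l.length_eq] at this
      exact this.trans (min_eq_left hk')
  · rintro ⟨v, l₁, l₂⟩ _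
    simp only [LinExt.append]
    rw [List.take_left' (by simp), List.drop_left' (by simp)]

/-- Ranks in a subforest differ from ranks in `F`, but both reflect the same preorder and so agree
after packing. -/
theorem LinExt.packedWord_restrict {F : PreForest} {s : Set F.V} (l : (F.restrict s).LinExt) :
    l.packedWord = packWord ((l.1.map (F.incl s)).map F.rank) := by
  rw [LinExt.packedWord, List.map_map]
  exact packWord_map_congr _ _ _ fun a _ b _ =>
    ((F.restrict s).rank_le_rank_iff a b).trans (F.rank_le_rank_iff a.1 b.1).symm

end PreForest

/-! ## The structure maps on basis elements -/

theorem Module.Basis.induction_linear {ι K M : Type*} [Field K] [AddCommGroup M] [Module K M]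
    (b : Module.Basis ι K M) {p : M → Prop} (x : M) (hb : ∀ i, p (b i)) (h0 : p 0)
    (hadd : ∀ x y, p x → p y → p (x + y)) (hsmul : ∀ (r : K) x, p x → p (r • x)) : p x := by
  have hx := b.mem_span x
  induction hx using Submodule.span_induction with
  | mem x hx => obtain ⟨i, rfl⟩ := hx; exact hb i
  | zero => exact h0
  | add x y _ _ hx hy => exact hadd x y hx hy
  | smul r x _ hx => exact hsmul r x hx

section

variable (K : Type*) [Field K]

theorem WQSym.mul_basis (σ τ : PackedWord) :
    (WQSym.maps K).mul (WQSym.basis K σ) (WQSym.basis K τ) = WQSym.mulWord K σ τ := by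
  simp [WQSym.maps]

/-- Cutting before packing is allowed. Since `w` need not be packed, the formula applies again to
its prefixes and suffixes. -/
theorem WQSym.comul_basis (w : List ℕ) :
    (WQSym.maps K).comul (WQSym.basis K (packWord w)) = ∑ k ∈ Finset.range (w.length + 1),
      WQSym.basis K (packWord (w.take k)) ⊗ₜ[K] WQSym.basis K (packWord (w.drop k)) := by
  simp only [WQSym.maps, Module.Basis.constr_basis, WQSym.comulWord]
  have hlen : (packWord w).length = w.length := length_pack w
  rw [hlen]
  refine Finset.sum_congr rfl fun k _ => ?_
  have h₁ : packWord ((packWord w).word.take k) = packWord (w.take k) :=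
    packWord_eq_packWord (pack_take_pack w k)
  have h₂ : packWord ((packWord w).word.drop k) = packWord (w.drop k) :=
    packWord_eq_packWord (pack_drop_pack w k)
  rw [h₁, h₂]

theorem WQSym.counit_basis (w : List ℕ) :
    (WQSym.maps K).counit (WQSym.basis K (packWord w)) = if w = [] then 1 else 0 := by
  classical
  simp only [WQSym.maps, Module.Basis.coord_apply, Module.Basis.repr_self, Finsupp.single_apply,
    packWord_eq_empty_iff]

theorem Hpo.mul_basis (c d : ForestClass) :
    (Hpo.maps K).mul (Hpo.basis K c) (Hpo.basis K d) = Hpo.basis K (c.prod d) := by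
  simp [Hpo.maps]

theorem Hpo.comul_basis (F : PreForest) :
    (Hpo.maps K).comul (Hpo.basis K ⟦F⟧)
      = ∑ v : F.Cut, Hpo.basis K ⟦F.lea v⟧ ⊗ₜ[K] Hpo.basis K ⟦F.roo v⟧ := by
  simp only [Hpo.maps, Module.Basis.constr_basis]
  rfl

theorem ForestClass.mk_eq_empty_iff (F : PreForest) :
    (⟦F⟧ : ForestClass) = ForestClass.empty ↔ IsEmpty F.V := by
  constructor
  · intro h
    obtain ⟨e⟩ := Quotient.exact h
    exact ⟨fun v => (e.toEquiv v).elim⟩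
  · intro h
    exact Quotient.sound ⟨⟨Equiv.equivOfIsEmpty F.V Empty, fun v => h.elim v, fun v => h.elim v⟩⟩

open Classical in
theorem Hpo.counit_basis (F : PreForest) :
    (Hpo.maps K).counit (Hpo.basis K ⟦F⟧) = if IsEmpty F.V then 1 else 0 := by
  simp only [Hpo.maps, Module.Basis.coord_apply, Module.Basis.repr_self, Finsupp.single_apply,
    ForestClass.mk_eq_empty_iff]

theorem Phi_basis (F : PreForest) :
    Phi K (Hpo.basis K ⟦F⟧) = ∑ l : F.LinExt, WQSym.basis K l.packedWord := by
  rw [← PreForest.wordSum_eq_sum]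
  simp only [Phi, Module.Basis.constr_basis]
  rfl

/-! ## `Phi` is compatible with the structure maps -/

open PreForest in
theorem WQSym.mulWord_packedWord {F G : PreForest} (u : F.LinExt) (v : G.LinExt) :
    WQSym.mulWord K u.packedWord v.packedWord = ((sumShuffles u.1 v.1).map
      fun m => WQSym.basis K (packWord (m.map (F.prod G).rank))).sum := by
  rw [WQSym.mulWord, v.word_packedWord, List.map_map]
  conv_lhs => enter [1, 2, 1]; rw [u.word_packedWord]
  rw [shuffles_map, List.map_map]
  refine congrArg List.sum (List.map_congr_left fun m _ => ?_)
  -- The shift in `mulWord` is the largest letter of the first word, which bounds the ranks of `F`.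
  have hN : ∀ x, F.rank x ≤ u.packedWord.max := fun x => u.packedWord.le_max (by
    rw [u.word_packedWord]
    exact List.mem_map_of_mem (u.2.1 x))
  rw [packWord_map_rank_prod m _ hN]
  rfl

theorem Phi_mul (x y : Hpo K) :
    Phi K ((Hpo.maps K).mul x y) = (WQSym.maps K).mul (Phi K x) (Phi K y) := by
  induction x using (Hpo.basis K).induction_linear with
  | h0 => simp
  | hadd x x' h h' => simp [h, h']
  | hsmul r x h => simp [h]
  | hb c =>
    induction y using (Hpo.basis K).induction_linear with
    | h0 => simp
    | hadd x x' h h' => simp [h, h']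
    | hsmul r x h => simp [h]
    | hb d =>
      induction c, d using Quotient.inductionOn₂ with
      | h F G =>
        have h : ForestClass.prod ⟦F⟧ ⟦G⟧ = ⟦F.prod G⟧ := rfl
        rw [Hpo.mul_basis, h, Phi_basis, Phi_basis, Phi_basis]
        simp only [map_sum, LinearMap.sum_apply, WQSym.mul_basis, WQSym.mulWord_packedWord]
        rw [Finset.sum_comm]
        exact PreForest.sum_linExt_prod F G fun m => WQSym.basis K (packWord (m.map (F.prod G).rank))

theorem Phi_comul (x : Hpo K) :
    TensorProduct.map (Phi K) (Phi K) ((Hpo.maps K).comul x) = (WQSym.maps K).comul (Phi K x) := by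
  induction x using (Hpo.basis K).induction_linear with
  | h0 => simp
  | hadd x x' h h' => simp only [map_add, h, h']
  | hsmul r x h => simp only [map_smul, h]
  | hb c =>
    induction c using Quotient.inductionOn with
    | h F =>
      rw [Hpo.comul_basis, Phi_basis, map_sum, map_sum]
      simp only [TensorProduct.map_tmul, Phi_basis, TensorProduct.sum_tmul, TensorProduct.tmul_sum]
      have h := F.sum_cut_linExt fun l₁ l₂ => WQSym.basis K (packWord (l₁.map F.rank)) ⊗ₜ[K]
        WQSym.basis K (packWord (l₂.map F.rank))
      refine Eq.trans ?_ (h.trans ?_)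
      · simp only [PreForest.lea, PreForest.roo, PreForest.LinExt.packedWord_restrict]
        exact Finset.sum_congr rfl fun v _ => Finset.sum_comm
      · refine Finset.sum_congr rfl fun l _ => ?_
        rw [PreForest.LinExt.packedWord, WQSym.comul_basis, List.length_map, l.length_eq]
        simp only [List.map_take, List.map_drop]

theorem Phi_counit (x : Hpo K) : (WQSym.maps K).counit (Phi K x) = (Hpo.maps K).counit x := by
  classical
  induction x using (Hpo.basis K).induction_linear with
  | h0 => simp
  | hadd x x' h h' => simp only [map_add, h, h']
  | hsmul r x h => simp only [map_smul, h]
  | hb c =>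
    induction c using Quotient.inductionOn with
    | h F =>
      rw [Phi_basis, Hpo.counit_basis, map_sum]
      simp only [PreForest.LinExt.packedWord, WQSym.counit_basis, List.map_eq_nil_iff]
      have hnil : ∀ l : F.LinExt, l.1 = [] ↔ IsEmpty F.V := fun l =>
        ⟨fun h => ⟨fun v => by simpa [h] using l.2.1 v⟩, fun h => List.eq_nil_of_length_eq_zero (by
          rw [l.length_eq, PreForest.degree, Nat.card_of_isEmpty])⟩
      simp only [hnil]
      -- The empty forest has one linear extension, the empty list; for any other forest no linear
      -- extension reads the empty word.
      split_ifs with h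
      · have : Unique F.LinExt :=
          { default := ⟨[], fun v => h.elim v, List.Pairwise.nil⟩
            uniq := fun l => Subtype.ext ((hnil l).2 h) }
        simp
      · simp

theorem Phi_one : Phi K (Hpo.maps K).one = (WQSym.maps K).one := by
  have h : Phi K (Hpo.basis K ⟦PreForest.empty⟧) = WQSym.basis K PackedWord.empty := by
    have hE : IsEmpty PreForest.empty.V := inferInstanceAs (IsEmpty Empty)
    have hnil : ∀ l : PreForest.empty.LinExt, l.1 = [] := fun l =>
      List.eq_nil_iff_forall_not_mem.2 fun v => hE.elim v
    have : Unique PreForest.empty.LinExt :=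
      { default := ⟨[], fun v => hE.elim v, List.Pairwise.nil⟩
        uniq := fun l => Subtype.ext (hnil l) }
    rw [Phi_basis, Fintype.sum_unique, PreForest.LinExt.packedWord, hnil, List.map_nil,
      (packWord_eq_empty_iff []).2 rfl]
  exact h

end

/-! ## Axioms for preordered forests -/

theorem Sum.liftRel_sumAssoc {α β γ : Type*} (r : α → α → Prop) (s : β → β → Prop)
    (t : γ → γ → Prop) (x y : (α ⊕ β) ⊕ γ) :
    Sum.LiftRel r (Sum.LiftRel s t) (Equiv.sumAssoc α β γ x) (Equiv.sumAssoc α β γ y)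
      ↔ Sum.LiftRel (Sum.LiftRel r s) t x y := by
  rcases x with (x | x) | x <;> rcases y with (y | y) | y <;> simp

theorem Sum.lex_sumAssoc {α β γ : Type*} (r : α → α → Prop) (s : β → β → Prop)
    (t : γ → γ → Prop) (x y : (α ⊕ β) ⊕ γ) :
    Sum.Lex r (Sum.Lex s t) (Equiv.sumAssoc α β γ x) (Equiv.sumAssoc α β γ y)
      ↔ Sum.Lex (Sum.Lex r s) t x y := by
  rcases x with (x | x) | x <;> rcases y with (y | y) | y <;> simp

namespace PreForest

theorem prod_assoc_equiv (F G H : PreForest) : (F.prod G).prod H ≈ F.prod (G.prod H) :=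
  ⟨⟨Equiv.sumAssoc F.V G.V H.V, Sum.liftRel_sumAssoc _ _ _, Sum.lex_sumAssoc _ _ _⟩⟩

theorem empty_prod_equiv (F : PreForest) : empty.prod F ≈ F := by
  refine ⟨⟨Equiv.emptySum Empty F.V, ?_, ?_⟩⟩
  · rintro (v | v) (w | w)
    iterate 3 first | exact Empty.elim v | exact Empty.elim w
    exact (Sum.liftRel_inr_inr (r := empty.edge) (s := F.edge)).symm
  · rintro (v | v) (w | w)
    iterate 3 first | exact Empty.elim v | exact Empty.elim w
    exact (Sum.lex_inr_inr (r := empty.le) (s := F.le)).symm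

theorem prod_empty_equiv (F : PreForest) : F.prod empty ≈ F := by
  refine ⟨⟨Equiv.sumEmpty F.V Empty, ?_, ?_⟩⟩
  · rintro (v | v) (w | w)
    · exact (Sum.liftRel_inl_inl (r := F.edge) (s := empty.edge)).symm
    all_goals first | exact Empty.elim v | exact Empty.elim w
  · rintro (v | v) (w | w)
    · exact (Sum.lex_inl_inl (r := F.le) (s := empty.le)).symm
    all_goals first | exact Empty.elim v | exact Empty.elim w

/-- The totally ordered forest whose only linear extension reads the packed word `τ`. -/
def ladder (τ : PackedWord) : PreForest where
  V := Fin τ.word.length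
  finite := inferInstance
  edge i j := (i : ℕ) + 1 = j
  edge_unique h h' := Fin.ext (h.symm.trans h')
  acyclic := by
    have key : ∀ i j : Fin τ.word.length,
        Relation.TransGen (fun i j : Fin τ.word.length => (i : ℕ) + 1 = j) i j → i < j := by
      intro i j h
      induction h with
      | single h => exact Fin.lt_def.2 (by omega)
      | tail _ h ih => exact ih.trans (Fin.lt_def.2 (by omega))
    exact fun i h => (key i i h).false
  le i j := τ.word.get i ≤ τ.word.get j
  le_refl _ := _root_.le_refl _
  le_trans h h' := _root_.le_trans h h'
  le_total _ _ := _root_.le_total _ _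

theorem reach_ladder {τ : PackedWord} (i j : Fin τ.word.length) :
    (ladder τ).reach i j ↔ i ≤ j := by
  constructor
  · intro h
    change Relation.ReflTransGen (fun i j : Fin τ.word.length => (i : ℕ) + 1 = j) i j at h
    induction h with
    | refl => exact _root_.le_refl i
    | tail _ h ih => exact ih.trans (Fin.le_def.2 (by omega))
  · intro h
    obtain ⟨j, hj⟩ := j
    have h : (i : ℕ) ≤ j := h
    induction j, h using Nat.le_induction with
    | base => exact .refl
    | succ j hij ih =>
      have hedge : (ladder τ).edge ⟨j, by omega⟩ ⟨j + 1, hj⟩ := rfl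
      exact Relation.ReflTransGen.tail (ih (by omega) (Fin.le_def.2 hij)) hedge

/-- The vertices form a single chain, so a linear extension has to list them in increasing order. -/
theorem linExt_ladder {τ : PackedWord} (l : (ladder τ).LinExt) :
    l.1 = List.finRange τ.word.length := by
  have h₁ : List.Pairwise (fun a b : Fin τ.word.length => a < b) l.1 :=
    l.2.2.imp fun {a b} h => not_le.1 fun h' => h ((reach_ladder b a).2 h')
  refine List.Perm.eq_of_pairwise (fun a b _ _ h h' => (lt_asymm h h').elim) h₁
    (List.pairwise_lt_finRange _) ?_
  exact (List.perm_ext_iff_of_nodup l.nodup (List.nodup_finRange _)).2 fun a =>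
    iff_of_true (l.2.1 a) (List.mem_finRange a)

end PreForest

section

variable (K : Type*) [Field K]

theorem Phi_ladder (τ : PackedWord) :
    Phi K (Hpo.basis K ⟦PreForest.ladder τ⟧) = WQSym.basis K τ := by
  have hl : ∀ v, v ∈ List.finRange τ.word.length := List.mem_finRange
  have : Unique (PreForest.ladder τ).LinExt :=
    { default := ⟨List.finRange τ.word.length, hl, by
        refine (List.pairwise_lt_finRange τ.word.length).imp fun {a b} h h' => ?_
        exact ((PreForest.reach_ladder b a).1 h').not_gt h⟩
      uniq := fun l => Subtype.ext (PreForest.linExt_ladder l) }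
  rw [Phi_basis, Fintype.sum_unique, PreForest.LinExt.packedWord, PreForest.linExt_ladder]
  congr 1
  have h₁ : packWord ((List.finRange τ.word.length).map (PreForest.ladder τ).rank)
      = packWord ((List.finRange τ.word.length).map τ.word.get) :=
    packWord_map_congr _ _ _ fun a _ b _ => (PreForest.ladder τ).rank_le_rank_iff a b
  refine h₁.trans ?_
  rw [List.map_get_finRange, packWord_word]

/-- Ladders reach every basis word. They need not be heap-preordered, so the argument requires the
whole of `Hpo`. -/
theorem Phi_surjective : Function.Surjective (Phi K) := by
  rw [← LinearMap.range_eq_top, eq_top_iff, ← (WQSym.basis K).span_eq, Submodule.span_le]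
  rintro _ ⟨τ, rfl⟩
  exact ⟨_, Phi_ladder K τ⟩

namespace Hpo

theorem mul_assoc (x y z : Hpo K) :
    (maps K).mul ((maps K).mul x y) z = (maps K).mul x ((maps K).mul y z) := by
  induction x using (basis K).induction_linear with
  | h0 => simp
  | hadd x x' h h' => simp [h, h']
  | hsmul r x h => simp [h]
  | hb c =>
    induction y using (basis K).induction_linear with
    | h0 => simp
    | hadd x x' h h' => simp [h, h']
    | hsmul r x h => simp [h]
    | hb d =>
      induction z using (basis K).induction_linear with
      | h0 => simp
      | hadd x x' h h' => simp [h, h']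
      | hsmul r x h => simp [h]
      | hb e =>
        simp only [mul_basis]
        induction c, d, e using Quotient.inductionOn₃ with
        | h F G H => exact congrArg _ (Quotient.sound (PreForest.prod_assoc_equiv F G H))

theorem one_mul (x : Hpo K) : (maps K).mul (maps K).one x = x := by
  induction x using (basis K).induction_linear with
  | h0 => simp
  | hadd x x' h h' => simp [h, h']
  | hsmul r x h => simp [h]
  | hb c =>
    refine (mul_basis K ForestClass.empty c).trans ?_
    induction c using Quotient.inductionOn with
    | h F => exact congrArg _ (Quotient.sound (PreForest.empty_prod_equiv F))

theorem mul_one (x : Hpo K) : (maps K).mul x (maps K).one = x := by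
  induction x using (basis K).induction_linear with
  | h0 => simp
  | hadd x x' h h' => simp [h, h']
  | hsmul r x h => simp [h]
  | hb c =>
    refine (mul_basis K c ForestClass.empty).trans ?_
    induction c using Quotient.inductionOn with
    | h F => exact congrArg _ (Quotient.sound (PreForest.prod_empty_equiv F))

theorem counit_mul (x y : Hpo K) :
    (maps K).counit ((maps K).mul x y) = (maps K).counit x * (maps K).counit y := by
  classical
  induction x using (basis K).induction_linear with
  | h0 => simp
  | hadd x x' h h' => simp [h, h', add_mul]
  | hsmul r x h => simp [h, _root_.mul_assoc]
  | hb c =>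
    induction y using (basis K).induction_linear with
    | h0 => simp
    | hadd x x' h h' => simp [h, h', mul_add]
    | hsmul r x h => simp [h, mul_left_comm]
    | hb d =>
      rw [mul_basis]
      induction c, d using Quotient.inductionOn₂ with
      | h F G =>
        have h : ForestClass.prod ⟦F⟧ ⟦G⟧ = ⟦F.prod G⟧ := rfl
        have h' : IsEmpty (F.prod G).V ↔ IsEmpty F.V ∧ IsEmpty G.V := isEmpty_sum
        rw [h, counit_basis, counit_basis, counit_basis]
        by_cases hF : IsEmpty F.V <;> by_cases hG : IsEmpty G.V <;> simp [h', hF, hG]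

/-- A cut of `FG` is a pair of cuts, and the parts above and below it are the products of the
corresponding parts. -/
theorem comul_mul (x y : Hpo K) : (maps K).comul ((maps K).mul x y)
    = TensorProduct.map₂ (maps K).mul (maps K).mul ((maps K).comul x) ((maps K).comul y) := by
  induction x using (basis K).induction_linear with
  | h0 => simp
  | hadd x x' h h' => simp only [map_add, LinearMap.add_apply, h, h']
  | hsmul r x h => simp only [map_smul, LinearMap.smul_apply, h]
  | hb c =>
    induction y using (basis K).induction_linear with
    | h0 => simp
    | hadd x x' h h' => simp only [map_add, h, h']
    | hsmul r x h => simp only [map_smul, h]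
    | hb d =>
      rw [mul_basis]
      induction c, d using Quotient.inductionOn₂ with
      | h F G =>
        have h : ForestClass.prod ⟦F⟧ ⟦G⟧ = ⟦F.prod G⟧ := rfl
        rw [h, comul_basis, comul_basis, comul_basis]
        simp only [map_sum, LinearMap.sum_apply]
        rw [Finset.sum_comm, ← Fintype.sum_prod_type', ← (PreForest.cutProdEquiv F G).sum_comp]
        refine Finset.sum_congr rfl fun p _ => ?_
        rw [TensorProduct.map₂_apply_tmul, TensorProduct.map_tmul, mul_basis, mul_basis]
        have h₁ : ForestClass.prod ⟦F.lea p.1⟧ ⟦G.lea p.2⟧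
            = ⟦(F.prod G).lea (PreForest.cutProdEquiv F G p)⟧ :=
          Quotient.sound (PreForest.restrict_prod_equiv F G _ _ _
            (PreForest.inl_mem_leaSet_iff p) (PreForest.inr_mem_leaSet_iff p))
        have h₂ : ForestClass.prod ⟦F.roo p.1⟧ ⟦G.roo p.2⟧
            = ⟦(F.prod G).roo (PreForest.cutProdEquiv F G p)⟧ :=
          Quotient.sound (PreForest.restrict_prod_equiv F G _ _ _
            (fun a => not_congr (PreForest.inl_mem_leaSet_iff p a))
            fun a => not_congr (PreForest.inr_mem_leaSet_iff p a))
        rw [h₁, h₂]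

end Hpo

theorem TensorProduct.map_map₂ {A B : Type*} [AddCommGroup A] [Module K A] [AddCommGroup B]
    [Module K B] (f : A →ₗ[K] B) (μ : A →ₗ[K] A →ₗ[K] A) (ν : B →ₗ[K] B →ₗ[K] B)
    (h : ∀ a b, f (μ a b) = ν (f a) (f b)) (x y : A ⊗[K] A) :
    TensorProduct.map f f (TensorProduct.map₂ μ μ x y)
      = TensorProduct.map₂ ν ν (TensorProduct.map f f x) (TensorProduct.map f f y) := by
  induction x with
  | zero => simp
  | add x x' hx hx' => simp only [map_add, LinearMap.add_apply, hx, hx']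
  | tmul a b =>
    induction y with
    | zero => simp
    | add y y' hy hy' => simp only [map_add, hy, hy']
    | tmul c d => simp [TensorProduct.map₂_apply_tmul, h]

/-! ## The Hopf algebra of packed words -/

namespace WQSym

/-- Inherited from disjoint unions through the surjection `Phi`, without expanding shuffles;
likewise for the unit laws and the multiplicativity statements that follow. -/
theorem mul_assoc (x y z : WQSym K) :
    (maps K).mul ((maps K).mul x y) z = (maps K).mul x ((maps K).mul y z) := by
  obtain ⟨x, rfl⟩ := Phi_surjective K x
  obtain ⟨y, rfl⟩ := Phi_surjective K y
  obtain ⟨z, rfl⟩ := Phi_surjective K z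
  simp only [← Phi_mul, Hpo.mul_assoc]

theorem one_mul (x : WQSym K) : (maps K).mul (maps K).one x = x := by
  obtain ⟨x, rfl⟩ := Phi_surjective K x
  rw [← Phi_one, ← Phi_mul, Hpo.one_mul]

theorem mul_one (x : WQSym K) : (maps K).mul x (maps K).one = x := by
  obtain ⟨x, rfl⟩ := Phi_surjective K x
  rw [← Phi_one, ← Phi_mul, Hpo.mul_one]

theorem counit_mul (x y : WQSym K) :
    (maps K).counit ((maps K).mul x y) = (maps K).counit x * (maps K).counit y := by
  obtain ⟨x, rfl⟩ := Phi_surjective K x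
  obtain ⟨y, rfl⟩ := Phi_surjective K y
  simp only [← Phi_mul, Phi_counit, Hpo.counit_mul]

theorem comul_mul (x y : WQSym K) : (maps K).comul ((maps K).mul x y)
    = TensorProduct.map₂ (maps K).mul (maps K).mul ((maps K).comul x) ((maps K).comul y) := by
  obtain ⟨x, rfl⟩ := Phi_surjective K x
  obtain ⟨y, rfl⟩ := Phi_surjective K y
  rw [← Phi_mul, ← Phi_comul, Hpo.comul_mul, ← Phi_comul, ← Phi_comul]
  exact TensorProduct.map_map₂ K (Phi K) _ _ (Phi_mul K) _ _

theorem one_eq : (maps K).one = basis K (packWord []) := by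
  rw [(packWord_eq_empty_iff []).2 rfl]
  rfl

theorem counit_one : (maps K).counit (maps K).one = 1 := by
  rw [one_eq, counit_basis, if_pos rfl]

theorem comul_one : (maps K).comul (maps K).one = (maps K).one ⊗ₜ[K] (maps K).one := by
  rw [one_eq, comul_basis]
  simp

/-- Each packed word is its own packing, so nothing is lost by testing on packings of arbitrary
words, where `comul_basis` applies directly. -/
theorem basis_ext {M : Type*} [AddCommGroup M] [Module K M] {f g : WQSym K →ₗ[K] M}
    (h : ∀ w : List ℕ, f (basis K (packWord w)) = g (basis K (packWord w))) : f = g :=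
  (basis K).ext fun τ => by simpa using h τ.word

theorem counit_rTensor :
    (maps K).counit.rTensor (WQSym K) ∘ₗ (maps K).comul = TensorProduct.mk K K (WQSym K) 1 := by
  refine basis_ext K fun w => ?_
  rw [LinearMap.comp_apply, comul_basis, map_sum, Finset.sum_eq_single 0]
  · simp [counit_basis]
  · intro k hk hk0
    have hk := Finset.mem_range_succ_iff.1 hk
    have : w.take k ≠ [] := by
      intro h
      have := congrArg List.length h
      simp only [List.length_take, List.length_nil] at this
      omega
    simp [counit_basis, this]
  · simp

theorem counit_lTensor :
    (maps K).counit.lTensor (WQSym K) ∘ₗ (maps K).comul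
      = (TensorProduct.mk K (WQSym K) K).flip 1 := by
  refine basis_ext K fun w => ?_
  rw [LinearMap.comp_apply, comul_basis, map_sum, Finset.sum_eq_single w.length]
  · simp [counit_basis]
  · intro k hk hk0
    have hk := Finset.mem_range_succ_iff.1 hk
    have : ¬ w.drop k = [] := by
      intro h
      have := congrArg List.length h
      simp only [List.length_drop, List.length_nil] at this
      omega
    rw [LinearMap.lTensor_tmul, counit_basis, if_neg this, TensorProduct.tmul_zero]
  · simp

theorem coassoc :
    TensorProduct.assoc K (WQSym K) (WQSym K) (WQSym K) ∘ₗ (maps K).comul.rTensor (WQSym K) ∘ₗ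
      (maps K).comul = (maps K).comul.lTensor (WQSym K) ∘ₗ (maps K).comul := by
  refine basis_ext K fun w => ?_
  simp only [LinearMap.comp_apply, comul_basis, map_sum, LinearMap.rTensor_tmul,
    LinearMap.lTensor_tmul, TensorProduct.sum_tmul, TensorProduct.tmul_sum,
    LinearEquiv.coe_coe, TensorProduct.assoc_tmul]
  rw [Finset.sum_sigma', Finset.sum_sigma']
  -- Cutting at `k` and then the left part at `j` is the same as cutting at `j` and then the right
  -- part at `k - j`.
  refine Finset.sum_nbij' (fun x => ⟨x.2, x.1 - x.2⟩) (fun x => ⟨x.1 + x.2, x.1⟩) ?_ ?_ ?_ ?_ ?_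
  · rintro ⟨k, j⟩ h
    simp only [Finset.mem_sigma, Finset.mem_range, List.length_take, List.length_drop] at h ⊢
    omega
  · rintro ⟨k, j⟩ h
    simp only [Finset.mem_sigma, Finset.mem_range, List.length_take, List.length_drop] at h ⊢
    omega
  · rintro ⟨k, j⟩ h
    simp only [Finset.mem_sigma, Finset.mem_range, List.length_take] at h
    have : j + (k - j) = k := by omega
    simp only [this]
  · rintro ⟨k, j⟩ _
    simp
  · rintro ⟨k, j⟩ h
    simp only [Finset.mem_sigma, Finset.mem_range, List.length_take] at h
    have h₁ : min j k = j := by omega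
    have h₂ : j + (k - j) = k := by omega
    simp only [List.take_take, List.drop_drop, List.drop_take, h₁, h₂]

end WQSym

/-! ### Gradings on words -/

theorem Phi_basis_mem_grading (F : PreForest) :
    Phi K (Hpo.basis K ⟦F⟧) ∈ WQSym.grading K F.degree := by
  rw [Phi_basis]
  refine Submodule.sum_mem _ fun l _ => Submodule.subset_span ⟨_, ?_, rfl⟩
  rw [Set.mem_ofPred_eq, PackedWord.length, l.word_packedWord, List.length_map, l.length_eq]

theorem Phi_mem_grading (n : ℕ) (x : Hpo K) (hx : x ∈ Hpo.grading K n) :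
    Phi K x ∈ WQSym.grading K n := by
  have : Hpo.grading K n ≤ (WQSym.grading K n).comap (Phi K) := by
    refine Submodule.span_le.2 ?_
    rintro _ ⟨c, hc, rfl⟩
    induction c using Quotient.inductionOn with
    | h F =>
      have hc : F.degree = n := hc
      exact hc ▸ Phi_basis_mem_grading K F
  exact this hx

namespace WQSym

theorem isGraded : (maps K).IsGraded (grading K) where
  isInternal := by
    refine DirectSum.isInternal_submodule_of_iSupIndep_of_iSup_eq_top ?_ ?_
    · exact iSupIndep_comap_span_basis (basis K) PackedWord.length LinearMap.id
        Function.injective_id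
    · rw [eq_top_iff, ← (basis K).span_eq, Submodule.span_le]
      rintro _ ⟨τ, rfl⟩
      exact Submodule.mem_iSup_of_mem τ.length (Submodule.subset_span ⟨τ, rfl, rfl⟩)
  one_mem := Submodule.subset_span ⟨_, rfl, rfl⟩
  mul_mem i j a ha b hb := by
    have h : ∀ σ τ : PackedWord,
        (maps K).mul (basis K σ) (basis K τ) ∈ grading K (σ.length + τ.length) := by
      intro σ τ
      have hd : ((PreForest.ladder σ).prod (PreForest.ladder τ)).degree = σ.length + τ.length := by
        rw [PreForest.degree]
        refine Nat.card_sum.trans ?_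
        simp only [PreForest.ladder, Nat.card_eq_fintype_card, Fintype.card_fin]
        rfl
      -- The product of two words is the image of a product of ladders, so its degree is a number of
      -- vertices and the lengths of shuffles need not be computed.
      rw [← Phi_ladder, ← Phi_ladder, ← Phi_mul, Hpo.mul_basis, ← hd]
      exact Phi_basis_mem_grading K _
    refine Submodule.span_induction₂ (p := fun x y _ _ => (maps K).mul x y ∈ grading K (i + j))
      ?_ ?_ ?_ ?_ ?_ ?_ ?_ ha hb
    · rintro _ _ ⟨c, rfl, rfl⟩ ⟨d, rfl, rfl⟩
      exact h c d
    · intro y _; simp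
    · intro x _; simp
    · intro x y z _ _ _ h h'; simpa using add_mem h h'
    · intro x y z _ _ _ h h'; simpa using add_mem h h'
    · intro r x y _ _ h; simpa using Submodule.smul_mem _ r h
    · intro r x y _ _ h; simpa using Submodule.smul_mem _ r h
  comul_mem n a ha := by
    suffices h : grading K n ≤ Submodule.comap (maps K).comul (⨆ p ∈
        Finset.HasAntidiagonal.antidiagonal n,
        LinearMap.range (TensorProduct.mapIncl (grading K p.1) (grading K p.2))) from h ha
    refine Submodule.span_le.2 ?_
    rintro _ ⟨τ, rfl, rfl⟩
    rw [SetLike.mem_coe, Submodule.mem_comap, ← packWord_word τ, comul_basis]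
    refine Submodule.sum_mem _ fun k hk => ?_
    have hk := Finset.mem_range_succ_iff.1 hk
    refine Submodule.mem_iSup_of_mem (k, τ.length - k) (Submodule.mem_iSup_of_mem ?_ ?_)
    · rw [Finset.HasAntidiagonal.mem_antidiagonal, packWord_word]
      exact Nat.add_sub_cancel' hk
    · refine ⟨⟨_, Submodule.subset_span ⟨_, ?_, rfl⟩⟩ ⊗ₜ ⟨_, Submodule.subset_span ⟨_, ?_, rfl⟩⟩,
        rfl⟩
      · refine (length_pack _).trans ?_
        rw [List.length_take]
        exact min_eq_left hk
      · refine (length_pack _).trans ?_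
        rw [List.length_drop]
        rfl
  counit_eq_zero n hn a ha := by
    refine (Submodule.span_le.2 ?_ : grading K n ≤ LinearMap.ker (maps K).counit) ha
    rintro _ ⟨τ, rfl, rfl⟩
    rw [SetLike.mem_coe, LinearMap.mem_ker, ← packWord_word τ, counit_basis, if_neg]
    rintro h
    exact hn (by rw [PackedWord.length, h, List.length_nil])

theorem eq_counit_smul_one (a : WQSym K) (ha : a ∈ grading K 0) :
    a = (maps K).counit a • (maps K).one := by
  refine (Submodule.span_le.2 ?_ : grading K 0 ≤ LinearMap.eqLocus LinearMap.id
    ((maps K).counit.smulRight (maps K).one)) ha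
  rintro _ ⟨τ, hτ, rfl⟩
  have h : τ.word = [] := List.eq_nil_of_length_eq_zero hτ
  rw [SetLike.mem_coe, LinearMap.mem_eqLocus, ← packWord_word τ, h, LinearMap.smulRight_apply,
    counit_basis, if_pos rfl, one_smul, one_eq]
  rfl

end WQSym

end

/-- Connected graded structure maps that satisfy the axioms of algebras and of coalgebras have an
antipode. -/
theorem StructureMaps.IsGraded.exists_antipode {K A : Type*} [Field K] [AddCommGroup A] [Module K A]
    {m : StructureMaps K A} {𝒜 : ℕ → Submodule K A} (hg : m.IsGraded 𝒜)
    (h0 : ∀ a ∈ 𝒜 0, a = m.counit a • m.one)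
    (mul_assoc : ∀ a b c, m.mul (m.mul a b) c = m.mul a (m.mul b c))
    (one_mul : ∀ a, m.mul m.one a = a)
    (mul_one : ∀ a, m.mul a m.one = a)
    (coassoc : TensorProduct.assoc K A A A ∘ₗ m.comul.rTensor A ∘ₗ m.comul
      = m.comul.lTensor A ∘ₗ m.comul)
    (counit_rTensor : m.counit.rTensor A ∘ₗ m.comul = TensorProduct.mk K K A 1)
    (counit_lTensor : m.counit.lTensor A ∘ₗ m.comul = (TensorProduct.mk K A K).flip 1) :
    ∃ S : A →ₗ[K] A,
      (∀ a, TensorProduct.lift m.mul (S.rTensor A (m.comul a)) = m.counit a • m.one) ∧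
      (∀ a, TensorProduct.lift m.mul (S.lTensor A (m.comul a)) = m.counit a • m.one) := by
  let _ : Ring A :=
    { (inferInstance : AddCommGroup A) with
      mul := fun a b => m.mul a b
      one := m.one
      mul_assoc := mul_assoc
      one_mul := one_mul
      mul_one := mul_one
      zero_mul := fun a => by change m.mul 0 a = 0; simp
      mul_zero := fun a => by change m.mul a 0 = 0; simp
      left_distrib := fun a b c => by change m.mul a (b + c) = m.mul a b + m.mul a c; simp
      right_distrib := fun a b c => by change m.mul (a + b) c = m.mul a c + m.mul b c; simp }
  let _ : Algebra K A := Algebra.ofModule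
    (fun r a b => by change m.mul (r • a) b = r • m.mul a b; simp)
    (fun r a b => by change m.mul a (r • b) = r • m.mul a b; simp)
  let _ : Coalgebra K A :=
    { comul := m.comul
      counit := m.counit
      coassoc := coassoc
      rTensor_counit_comp_comul := counit_rTensor
      lTensor_counit_comp_comul := counit_lTensor }
  obtain ⟨S, h₁, h₂⟩ := exists_antipode_of_connected (K := K) 𝒜
    hg.isInternal.submodule_iSup_eq_top hg.comul_mem fun a ha =>
      (h0 a ha).trans (Algebra.algebraMap_eq_smul_one (A := A) (m.counit a)).symm
  refine ⟨S.ofConv, fun a => ?_, fun a => ?_⟩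
  · have h := LinearMap.congr_fun (congrArg WithConv.ofConv h₁) a
    exact h.trans (Algebra.algebraMap_eq_smul_one (A := A) (m.counit a))
  · have h := LinearMap.congr_fun (congrArg WithConv.ofConv h₂) a
    exact h.trans (Algebra.algebraMap_eq_smul_one (A := A) (m.counit a))

theorem WQSym.isHopf (K : Type*) [Field K] : (WQSym.maps K).IsHopf where
  mul_assoc := WQSym.mul_assoc K
  one_mul := WQSym.one_mul K
  mul_one := WQSym.mul_one K
  coassoc := WQSym.coassoc K
  counit_rTensor := WQSym.counit_rTensor K
  counit_lTensor := WQSym.counit_lTensor K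
  counit_one := WQSym.counit_one K
  counit_mul := WQSym.counit_mul K
  comul_one := WQSym.comul_one K
  comul_mul := WQSym.comul_mul K
  exists_antipode := (WQSym.isGraded K).exists_antipode (WQSym.eq_counit_smul_one K)
    (WQSym.mul_assoc K) (WQSym.one_mul K) (WQSym.mul_one K) (WQSym.coassoc K)
    (WQSym.counit_rTensor K) (WQSym.counit_lTensor K)

/-! ## Heap-preordered forests are determined by their leading words -/

namespace PreForest

theorem exists_edge_and_reach_of_reach {F : PreForest} {v x : F.V} (h : F.reach v x) (hne : v ≠ x) :
    ∃ p, F.edge v p ∧ F.reach p x := by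
  rcases Relation.ReflTransGen.cases_head h with h | h
  · exact (hne h).elim
  · exact h

theorem ne_of_edge {F : PreForest} {v w : F.V} (h : F.edge v w) : v ≠ w := by
  rintro rfl
  exact F.acyclic v (.single h)

theorem IsHeap.rank_lt {F : PreForest} (hF : F.IsHeap) {v w : F.V} (hne : v ≠ w)
    (h : F.reach v w) : F.rank w < F.rank v := by
  have := hF v w hne h
  rw [← F.rank_le_rank_iff v w] at this
  exact not_le.1 this.2

/-- Listing the vertices by decreasing rank works: in a heap-preordered forest, proper descendants
have strictly larger rank. -/
theorem IsHeap.nonempty_linExt {F : PreForest} (hF : F.IsHeap) : Nonempty F.LinExt := by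
  classical
  have := Fintype.ofFinite F.V
  set l := (Finset.univ : Finset F.V).toList.mergeSort (fun a b => decide (F.rank b ≤ F.rank a))
    with hl
  have hperm : l.Perm (Finset.univ : Finset F.V).toList := List.mergeSort_perm _ _
  have hnodup : l.Nodup := hperm.nodup_iff.2 (Finset.nodup_toList _)
  have hpw : l.Pairwise fun a b => decide (F.rank b ≤ F.rank a) = true := by
    refine List.pairwise_mergeSort (fun a b c h h' => ?_) (fun a b => ?_) _
    · simp only [decide_eq_true_eq] at h h' ⊢
      exact h'.trans h
    · simpa using _root_.le_total (F.rank b) (F.rank a)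
  refine ⟨⟨l, fun v => hperm.mem_iff.2 (by simp), (hpw.and hnodup).imp ?_⟩⟩
  rintro a b ⟨h, hne⟩ hr
  exact (hF.rank_lt hne.symm hr).not_ge (of_decide_eq_true h)

/-- The linear extension `l` reads the largest possible word, words being compared
lexicographically from right to left. -/
def LinExt.IsLeading {F : PreForest} (l : F.LinExt) : Prop :=
  ∀ l' : F.LinExt, (l'.1.map F.rank).reverse ≤ (l.1.map F.rank).reverse

theorem IsHeap.exists_isLeading {F : PreForest} (hF : F.IsHeap) : ∃ l : F.LinExt, l.IsLeading := by
  have := hF.nonempty_linExt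
  exact Finite.exists_max fun l : F.LinExt => (l.1.map F.rank).reverse

/-- In a leading linear extension, a vertex comes before a vertex of smaller rank only if its
successor is not after the latter. -/
theorem LinExt.IsLeading.exists_edge {F : PreForest} {l : F.LinExt} (hl : l.IsLeading)
    {s m t : List F.V} {v u : F.V} (e : l.1 = s ++ v :: (m ++ u :: t)) (huv : F.rank u < F.rank v) :
    ∃ p ∈ m ++ [u], F.edge v p := by
  by_contra hno
  push Not at hno
  have hnd := l.nodup
  have hpw := l.2.2
  have hmem := l.2.1
  rw [e] at hnd hpw hmem
  -- A path from `v` to `x` would start at the successor of `v`, which by assumption lies in `t`,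
  -- after `x`; but the successor would reach `x`, contrary to the order in `l`.
  have hvr : ∀ x ∈ m ++ [u], ¬ F.reach v x := by
    intro x hx hr
    have hxv : v ≠ x := by
      rintro rfl
      have h₁ := (List.nodup_cons.1 (List.nodup_append.1 hnd).2.1).1
      exact h₁ (by simp only [List.mem_append, List.mem_cons, List.not_mem_nil, or_false] at hx ⊢; tauto)
    obtain ⟨p, hvp, hpx⟩ := exists_edge_and_reach_of_reach hr hxv
    have hpw₁ := List.pairwise_append.1 hpw
    have hpw₂ := List.pairwise_cons.1 hpw₁.2.1
    have hpw₃ : (m ++ [u] ++ t).Pairwise fun a b => ¬ F.reach b a := by simpa using hpw₂.2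
    have hp : p ∈ t := by
      have h₁ := hmem p
      rw [List.mem_append, List.mem_cons, List.append_cons, List.mem_append] at h₁
      rcases h₁ with h | h | h | h
      · exact (hpw₁.2.2 p h v (by simp) (.single hvp)).elim
      · exact (ne_of_edge hvp h.symm).elim
      · exact (hno p h hvp).elim
      · exact h
    exact (List.pairwise_append.1 hpw₃).2.2 x hx p hp hpx
  -- The competing linear extension moves `v` to the place just after `u`.
  have hperm : (s ++ v :: (m ++ u :: t)).Perm (s ++ (m ++ u :: v :: t)) := by
    refine List.Perm.append_left s ?_
    rw [List.append_cons m u t, List.append_cons m u (v :: t)]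
    exact List.perm_middle.symm
  have hpw' : (s ++ (m ++ u :: v :: t)).Pairwise fun a b => ¬ F.reach b a := by
    have h₁ := List.pairwise_append.1 hpw
    have h₂ := List.pairwise_cons.1 h₁.2.1
    rw [List.append_cons m u t] at h₂
    rw [List.append_cons m u (v :: t)]
    have h₃ := List.pairwise_append.1 h₂.2
    refine List.pairwise_append.2 ⟨h₁.1, List.pairwise_append.2 ⟨h₃.1, List.pairwise_cons.2
      ⟨fun a ha => h₂.1 a (List.mem_append_right _ ha), h₃.2.1⟩, ?_⟩, ?_⟩
    · intro a ha b hb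
      rcases List.mem_cons.1 hb with rfl | hb
      · exact hvr a ha
      · exact h₃.2.2 a ha b hb
    · intro a ha b hb
      refine h₁.2.2 a ha b ?_
      simp only [List.mem_append, List.mem_cons, List.not_mem_nil, or_false] at hb ⊢
      tauto
  -- Read from the right, the two words agree along `t`; then the competitor has the rank of `v`
  -- against the smaller rank of `u`, so it exceeds the leading word.
  have hle := hl ⟨_, fun x => hperm.mem_iff.1 (hmem x), hpw'⟩
  rw [e] at hle
  refine hle.not_gt ?_
  simp only [List.map_append, List.map_cons, List.reverse_append, List.reverse_cons,
    List.append_assoc]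
  exact List.append_left_lt (List.cons_lt_cons_iff.2 (Or.inl huv))

/-- In a leading linear extension of a heap-preordered forest, the successor of a vertex is the
first vertex of smaller rank after it. -/
theorem LinExt.IsLeading.edge_iff {F : PreForest} (hF : F.IsHeap) {l : F.LinExt} (hl : l.IsLeading)
    (v p : F.V) : F.edge v p ↔ ∃ s m t, l.1 = s ++ v :: (m ++ p :: t) ∧ F.rank p < F.rank v ∧
      ∀ x ∈ m, F.rank v ≤ F.rank x := by
  constructor
  · intro h
    obtain ⟨s, r, e⟩ := List.append_of_mem (l.2.1 v)
    have hpw := l.2.2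
    have hmem := l.2.1 p
    have hnd := l.nodup
    rw [e] at hpw hmem
    have hp : p ∈ r := by
      rw [List.mem_append, List.mem_cons] at hmem
      rcases hmem with h' | h' | h'
      · exact ((List.pairwise_append.1 hpw).2.2 p h' v (by simp) (.single h)).elim
      · exact (ne_of_edge h h'.symm).elim
      · exact h'
    obtain ⟨m, t, rfl⟩ := List.append_of_mem hp
    refine ⟨s, m, t, e, hF.rank_lt (ne_of_edge h) (.single h), fun x hx => ?_⟩
    -- A vertex `x` of smaller rank between `v` and `p` would force the successor of `v` to occur no
    -- later than `x`; but this successor is `p`, which comes after `x`.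
    by_contra hlt
    obtain ⟨m₁, m₂, rfl⟩ := List.append_of_mem hx
    have e' : l.1 = s ++ v :: (m₁ ++ x :: (m₂ ++ p :: t)) := by simpa using e
    obtain ⟨p', hp', hvp'⟩ := hl.exists_edge e' (not_le.1 hlt)
    obtain rfl := F.edge_unique h hvp'
    have hnd' : ((s ++ v :: (m₁ ++ [x])) ++ (m₂ ++ p :: t)).Nodup := by
      rw [e'] at hnd
      simpa using hnd
    exact (List.nodup_append.1 hnd').2.2 p
      (List.mem_append_right _ (List.mem_cons_of_mem _ hp')) p (by simp) rfl
  · rintro ⟨s, m, t, e, hlt, hm⟩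
    obtain ⟨p', hp', hvp'⟩ := hl.exists_edge e hlt
    rcases List.mem_append.1 hp' with h | h
    · exact ((hm p' h).not_gt (hF.rank_lt (ne_of_edge hvp') (.single hvp'))).elim
    · rwa [← List.mem_singleton.1 h]

theorem edge_of_isLeading {F G : PreForest} (hF : F.IsHeap) (hG : G.IsHeap) {l : F.LinExt}
    {l' : G.LinExt} (hl : l.IsLeading) (hl' : l'.IsLeading) (e : F.V ≃ G.V) (he : l.1.map e = l'.1)
    (hr : ∀ v, G.rank (e v) = F.rank v) {v p : F.V} (h : F.edge v p) : G.edge (e v) (e p) := by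
  rw [hl.edge_iff hF] at h
  obtain ⟨s, m, t, h₁, h₂, h₃⟩ := h
  rw [hl'.edge_iff hG]
  refine ⟨s.map e, m.map e, t.map e, ?_, by rwa [hr, hr], fun x hx => ?_⟩
  · rw [← he, h₁]
    simp
  · obtain ⟨y, hy, rfl⟩ := List.mem_map.1 hx
    rw [hr, hr]
    exact h₃ y hy

/-- Matching the two lists position by position preserves ranks, hence the preorder; by `edge_iff`
the edges too are read off from the word alone. -/
theorem equiv_of_isLeading {F G : PreForest} (hF : F.IsHeap) (hG : G.IsHeap) {l : F.LinExt}
    {l' : G.LinExt} (hl : l.IsLeading) (hl' : l'.IsLeading)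
    (h : l.1.map F.rank = l'.1.map G.rank) : F ≈ G := by
  classical
  have hlen : l.1.length = l'.1.length := by simpa using congrArg List.length h
  let e : F.V ≃ G.V := ((List.Nodup.getEquivOfForallMemList l.1 l.nodup l.2.1).symm.trans
    (finCongr hlen)).trans (List.Nodup.getEquivOfForallMemList l'.1 l'.nodup l'.2.1)
  have he : l.1.map e = l'.1 := by
    refine List.ext_getElem (by simpa using hlen) fun i h₁ h₂ => ?_
    have h₃ : i < l.1.length := by simpa using h₁
    have h₄ : l.1[i] = List.Nodup.getEquivOfForallMemList l.1 l.nodup l.2.1 ⟨i, h₃⟩ := rfl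
    rw [List.getElem_map, h₄]
    simp only [e, Equiv.trans_apply, Equiv.symm_apply_apply]
    rfl
  have hr : ∀ v, G.rank (e v) = F.rank v := fun v => by
    have h' : l.1.map (fun v => G.rank (e v)) = l.1.map F.rank := by
      rw [h, ← he, List.map_map]
      rfl
    exact List.map_inj_left.1 h' v (l.2.1 v)
  refine ⟨⟨e, fun v w => ⟨fun h => ?_, edge_of_isLeading hF hG hl hl' e he hr⟩, fun v w => ?_⟩⟩
  · have := edge_of_isLeading hG hF hl' hl e.symm (by rw [← he]; simp)
      (fun v => by rw [← hr, e.apply_symm_apply]) h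
    simpa using this
  · rw [← F.rank_le_rank_iff, ← G.rank_le_rank_iff, hr, hr]

end PreForest

/-! ### Leading words and injectivity -/

section

variable (K : Type*) [Field K]

/-- The coefficient is the number of linear extensions reading `τ`; characteristic zero keeps a
positive number from vanishing. -/
theorem Phi_basis_coord [CharZero K] (F : PreForest) (τ : PackedWord) :
    (WQSym.basis K).repr (Phi K (Hpo.basis K ⟦F⟧)) τ ≠ 0 ↔
      ∃ l : F.LinExt, l.packedWord = τ := by
  classical
  rw [Phi_basis, map_sum, Finsupp.finsetSum_apply]
  simp only [Module.Basis.repr_self, Finsupp.single_apply]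
  rw [Finset.sum_boole, Nat.cast_ne_zero, Finset.card_ne_zero]
  simp [Finset.Nonempty]

theorem ForestClass.exists_leading_word [CharZero K] : ∃ T : ForestClass → PackedWord,
    (∀ c : ForestClass, c.IsHeap →
      (WQSym.basis K).repr (Phi K (Hpo.basis K c)) (T c) ≠ 0 ∧
      ∀ τ, (WQSym.basis K).repr (Phi K (Hpo.basis K c)) τ ≠ 0 →
        τ.word.reverse ≤ (T c).word.reverse) ∧
    ∀ c d : ForestClass, c.IsHeap → d.IsHeap → T c = T d → c = d := by
  have key : ∀ c : ForestClass, ∃ τ : PackedWord, c.IsHeap →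
      ∃ (F : PreForest) (l : F.LinExt), c = ⟦F⟧ ∧ F.IsHeap ∧ l.IsLeading ∧ l.packedWord = τ := by
    intro c
    induction c using Quotient.inductionOn with
    | h F =>
      by_cases hF : F.IsHeap
      · obtain ⟨l, hl⟩ := hF.exists_isLeading
        exact ⟨l.packedWord, fun _ => ⟨F, l, rfl, hF, hl, rfl⟩⟩
      -- An arbitrary value: leading words are only used for heap-preordered forests.
      · exact ⟨PackedWord.empty, fun h => (hF h).elim⟩
  choose T hT using key
  refine ⟨T, fun c hc => ?_, fun c d hc hd hcd => ?_⟩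
  · obtain ⟨F, l, rfl, -, hl, hlT⟩ := hT c hc
    refine ⟨(Phi_basis_coord K F _).2 ⟨l, hlT⟩, fun τ hτ => ?_⟩
    obtain ⟨l', rfl⟩ := (Phi_basis_coord K F τ).1 hτ
    rw [← hlT, l.word_packedWord, l'.word_packedWord]
    exact hl l'
  · obtain ⟨F, l, rfl, hF, hl, hlT⟩ := hT c hc
    obtain ⟨G, l', rfl, hG, hl', hlT'⟩ := hT d hd
    refine Quotient.sound (PreForest.equiv_of_isLeading hF hG hl hl' ?_)
    rw [← l.word_packedWord, ← l'.word_packedWord, hlT, hlT', hcd]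

theorem Hhpo.isHeap_of_mem {x : Hpo K} (hx : x ∈ Hhpo K) {c : ForestClass}
    (hc : c ∈ ((Hpo.basis K).repr x).support) : c.IsHeap :=
  (Hpo.basis K).mem_span_image.1 hx hc

/-- Take `c` in the support of `x` with the largest leading word. If `T c` occurs in the image of
another `d` of the support, then `T c ≤ T d ≤ T c` in the reversed order, so `d = c`. The
coefficient of `T c` thus comes from `c` alone and cannot cancel. -/
theorem Hhpo.eq_zero_of_Phi_eq_zero [CharZero K] {x : Hpo K} (hx : x ∈ Hhpo K)
    (h : Phi K x = 0) : x = 0 := by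
  classical
  by_contra hne
  obtain ⟨T, hT, hinj⟩ := ForestClass.exists_leading_word K
  have hs : ((Hpo.basis K).repr x).support.Nonempty := by
    rw [Finsupp.support_nonempty_iff]
    simpa using hne
  obtain ⟨c, hc, hmax⟩ := Finset.exists_max_image _ (fun c => (T c).word.reverse) hs
  have hcH := Hhpo.isHeap_of_mem K hx hc
  have h₁ : (WQSym.basis K).repr (Phi K x) (T c) = ∑ d ∈ ((Hpo.basis K).repr x).support,
      (Hpo.basis K).repr x d * (WQSym.basis K).repr (Phi K (Hpo.basis K d)) (T c) := by
    conv_lhs => rw [← (Hpo.basis K).linearCombination_repr x]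
    rw [Finsupp.linearCombination_apply, Finsupp.sum, map_sum, map_sum, Finsupp.finsetSum_apply]
    simp
  rw [h, map_zero, Finsupp.zero_apply, Finset.sum_eq_single c] at h₁
  · exact mul_ne_zero (Finsupp.mem_support_iff.1 hc) (hT c hcH).1 h₁.symm
  · intro d hd hdc
    by_contra hne
    have hdH := Hhpo.isHeap_of_mem K hx hd
    have h₂ := (hT d hdH).2 _ (right_ne_zero_of_mul hne)
    have h₃ := le_antisymm (hmax d hd) h₂
    exact hdc (hinj d c hdH hcH (PackedWord.ext_word (List.reverse_injective h₃)))
  · exact fun h => (h hc).elim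

end

/-! ## The Hopf algebra of heap-preordered forests -/

/-- An injective linear map that is compatible with structure maps pulls back the axioms of Hopf
algebras, once the source is graded and connected. -/
theorem StructureMaps.IsHopf.of_injective {K A B : Type*} [Field K] [AddCommGroup A] [Module K A]
    [AddCommGroup B] [Module K B] {m : StructureMaps K A} {m' : StructureMaps K B} (hB : m'.IsHopf)
    (f : A →ₗ[K] B) (hf : Function.Injective f) (f_mul : ∀ x y, f (m.mul x y) = m'.mul (f x) (f y))
    (f_one : f m.one = m'.one)
    (f_comul : ∀ x, TensorProduct.map f f (m.comul x) = m'.comul (f x))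
    (f_counit : ∀ x, m'.counit (f x) = m.counit x) {𝒜 : ℕ → Submodule K A} (hg : m.IsGraded 𝒜)
    (h0 : ∀ a ∈ 𝒜 0, a = m.counit a • m.one) : m.IsHopf := by
  have : Module.Free K A := Module.Free.of_divisionRing K A
  have : Module.Free K B := Module.Free.of_divisionRing K B
  -- Everything is flat over a field, so tensor products of `f` stay injective and identities can be
  -- tested in tensor powers of `B`.
  have hff : Function.Injective (TensorProduct.map f f) :=
    TensorProduct.map_injective_of_flat_flat _ _ hf hf
  have hfff : Function.Injective (TensorProduct.map f (TensorProduct.map f f)) :=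
    TensorProduct.map_injective_of_flat_flat _ _ hf hff
  have f_comul' : TensorProduct.map f f ∘ₗ m.comul = m'.comul ∘ₗ f := LinearMap.ext f_comul
  have f_counit' : m'.counit ∘ₗ f = m.counit := LinearMap.ext f_counit
  have mul_assoc : ∀ a b c, m.mul (m.mul a b) c = m.mul a (m.mul b c) := fun a b c =>
    hf (by simp only [f_mul, hB.mul_assoc])
  have one_mul : ∀ a, m.mul m.one a = a := fun a => hf (by rw [f_mul, f_one, hB.one_mul])
  have mul_one : ∀ a, m.mul a m.one = a := fun a => hf (by rw [f_mul, f_one, hB.mul_one])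
  have coassoc : TensorProduct.assoc K A A A ∘ₗ m.comul.rTensor A ∘ₗ m.comul
      = m.comul.lTensor A ∘ₗ m.comul := by
    refine LinearMap.ext fun x => hfff ?_
    have h₁ : ∀ t : A ⊗[K] A, TensorProduct.map f (TensorProduct.map f f)
        (TensorProduct.assoc K A A A (m.comul.rTensor A t))
        = TensorProduct.assoc K B B B (m'.comul.rTensor B (TensorProduct.map f f t)) := by
      intro t
      rw [TensorProduct.map_map_assoc, ← LinearMap.comp_apply, LinearMap.map_comp_rTensor, f_comul',
        ← LinearMap.comp_apply (m'.comul.rTensor B), LinearMap.rTensor_comp_map]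
    have h₂ : ∀ t : A ⊗[K] A, TensorProduct.map f (TensorProduct.map f f) (m.comul.lTensor A t)
        = m'.comul.lTensor B (TensorProduct.map f f t) := by
      intro t
      rw [← LinearMap.comp_apply, LinearMap.map_comp_lTensor, f_comul',
        ← LinearMap.comp_apply (m'.comul.lTensor B), LinearMap.lTensor_comp_map]
    have h₃ := LinearMap.congr_fun hB.coassoc (f x)
    simp only [LinearMap.comp_apply, LinearEquiv.coe_coe] at h₃ ⊢
    rw [h₁, h₂, f_comul, h₃]
  have counit_rTensor : m.counit.rTensor A ∘ₗ m.comul = TensorProduct.mk K K A 1 := by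
    refine LinearMap.ext fun x => Module.Flat.lTensor_preserves_injective_linearMap (M := K) f hf ?_
    have h₃ := LinearMap.congr_fun hB.counit_rTensor (f x)
    rw [LinearMap.comp_apply, ← f_comul, ← LinearMap.comp_apply, LinearMap.rTensor_comp_map,
      f_counit'] at h₃
    rw [LinearMap.comp_apply, ← LinearMap.comp_apply (LinearMap.lTensor K f),
      LinearMap.lTensor_comp_rTensor]
    exact h₃
  have counit_lTensor : m.counit.lTensor A ∘ₗ m.comul = (TensorProduct.mk K A K).flip 1 := by
    refine LinearMap.ext fun x => Module.Flat.rTensor_preserves_injective_linearMap (M := K) f hf ?_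
    have h₃ := LinearMap.congr_fun hB.counit_lTensor (f x)
    rw [LinearMap.comp_apply, ← f_comul, ← LinearMap.comp_apply, LinearMap.lTensor_comp_map,
      f_counit'] at h₃
    rw [LinearMap.comp_apply, ← LinearMap.comp_apply (LinearMap.rTensor K f),
      LinearMap.rTensor_comp_lTensor]
    exact h₃
  exact
    { mul_assoc := mul_assoc
      one_mul := one_mul
      mul_one := mul_one
      coassoc := coassoc
      counit_rTensor := counit_rTensor
      counit_lTensor := counit_lTensor
      counit_one := by rw [← f_counit, f_one, hB.counit_one]
      counit_mul := fun a b => by rw [← f_counit, f_mul, hB.counit_mul, f_counit, f_counit]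
      comul_one := hff (by rw [f_comul, f_one, hB.comul_one, TensorProduct.map_tmul, f_one])
      comul_mul := fun a b => hff (by
        rw [f_comul, f_mul, hB.comul_mul, TensorProduct.map_map₂ K f _ _ f_mul, f_comul, f_comul])
      exists_antipode := hg.exists_antipode h0 mul_assoc one_mul mul_one coassoc counit_rTensor
        counit_lTensor }

theorem PreForest.degree_lea_add_degree_roo (F : PreForest) (v : F.Cut) :
    (F.lea v).degree + (F.roo v).degree = F.degree := Set.ncard_add_ncard_compl (F.leaSet v)

theorem ForestClass.degree_prod (c d : ForestClass) : (c.prod d).degree = c.degree + d.degree := by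
  induction c, d using Quotient.inductionOn₂ with
  | h F G => exact Nat.card_sum (α := F.V) (β := G.V)

namespace Hhpo

variable (K : Type*) [Field K]

/-- A heap-preordered forest as a basis element of `Hhpo K`. -/
noncomputable def ofForest (F : PreForest) (hF : F.IsHeap) : Hhpo K :=
  ⟨Hpo.basis K ⟦F⟧, single_mem K (c := ⟦F⟧) hF⟩

theorem mem_of_support {N : Submodule K (Hhpo K)} (x : Hhpo K)
    (h : ∀ F hF, (⟦F⟧ : ForestClass) ∈ ((Hpo.basis K).repr x).support → ofForest K F hF ∈ N) :
    x ∈ N := by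
  classical
  have hx : x = ∑ c ∈ ((Hpo.basis K).repr x).support.attach, (Hpo.basis K).repr x c •
      (⟨Hpo.basis K c, single_mem K (isHeap_of_mem K x.2 c.2)⟩ : Hhpo K) := by
    refine Subtype.ext ?_
    rw [Submodule.coe_sum]
    simp only [Submodule.coe_smul]
    rw [Finset.sum_attach _ fun c => (Hpo.basis K).repr x c • Hpo.basis K c]
    exact ((Hpo.basis K).linearCombination_repr x).symm
  rw [hx]
  refine Submodule.sum_mem _ fun c _ => Submodule.smul_mem _ _ ?_
  obtain ⟨c, hc⟩ := c
  induction c using Quotient.inductionOn with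
  | h F => exact h F (isHeap_of_mem K x.2 hc) hc

/-- The component is an intersection of two spans of basis elements, so the support of a member
contains only forests that are both heap-preordered and of degree `n`. -/
theorem grading_le {N : Submodule K (Hhpo K)} {n : ℕ}
    (h : ∀ F hF, F.degree = n → ofForest K F hF ∈ N) : grading K n ≤ N := fun x hx =>
  mem_of_support K x fun F hF hc => h F hF ((Hpo.basis K).mem_span_image.1 hx hc)

theorem ofForest_mem_grading (F : PreForest) (hF : F.IsHeap) :
    ofForest K F hF ∈ grading K F.degree := Submodule.subset_span ⟨⟦F⟧, rfl, rfl⟩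

theorem comul_ofForest (F : PreForest) (hF : F.IsHeap) :
    (maps K).comul (ofForest K F hF) = ∑ v : F.Cut,
      ofForest K (F.lea v) (hF.restrict _) ⊗ₜ[K] ofForest K (F.roo v) (hF.restrict _) := by
  refine tensorIncl_injective K ?_
  rw [tensorIncl_comul, map_sum]
  exact Hpo.comul_basis K F

theorem counit_ofForest_of_degree_ne_zero {F : PreForest} (hF : F.IsHeap) (h : F.degree ≠ 0) :
    (maps K).counit (ofForest K F hF) = 0 := by
  refine (Hpo.counit_basis K F).trans (if_neg fun hE => h ?_)
  exact Finite.card_eq_zero_iff.2 hE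

theorem isGraded : (maps K).IsGraded (grading K) where
  isInternal := by
    refine DirectSum.isInternal_submodule_of_iSupIndep_of_iSup_eq_top ?_ ?_
    · exact iSupIndep_comap_span_basis (Hpo.basis K) ForestClass.degree (Hhpo K).subtype
        Subtype.val_injective
    · exact eq_top_iff.2 fun x _ => mem_of_support K x fun F hF _ =>
        Submodule.mem_iSup_of_mem F.degree (ofForest_mem_grading K F hF)
  one_mem := by
    have h : PreForest.empty.degree = 0 := Nat.card_of_isEmpty (α := Empty)
    exact h ▸ ofForest_mem_grading K PreForest.empty PreForest.isHeap_empty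
  mul_mem i j a ha b hb := by
    refine Submodule.span_induction₂ (p := fun x y _ _ =>
      (Hpo.maps K).mul x y ∈ Hpo.grading K (i + j)) ?_ ?_ ?_ ?_ ?_ ?_ ?_ ha hb
    · rintro _ _ ⟨c, rfl, rfl⟩ ⟨d, rfl, rfl⟩
      simp only [Hpo.mul_basis, ← ForestClass.degree_prod]
      exact Submodule.subset_span ⟨_, rfl, rfl⟩
    · intro y _; simp
    · intro x _; simp
    · intro x y z _ _ _ h h'; simpa using add_mem h h'
    · intro x y z _ _ _ h h'; simpa using add_mem h h'
    · intro r x y _ _ h; simpa using Submodule.smul_mem _ r h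
    · intro r x y _ _ h; simpa using Submodule.smul_mem _ r h
  comul_mem n a ha := by
    suffices h : grading K n ≤ Submodule.comap (maps K).comul (⨆ p ∈
        Finset.HasAntidiagonal.antidiagonal n,
        LinearMap.range (TensorProduct.mapIncl (grading K p.1) (grading K p.2))) from h ha
    refine grading_le K fun F hF hn => ?_
    rw [Submodule.mem_comap, comul_ofForest]
    refine Submodule.sum_mem _ fun v _ => ?_
    refine Submodule.mem_iSup_of_mem ((F.lea v).degree, (F.roo v).degree)
      (Submodule.mem_iSup_of_mem ?_ ?_)
    · rw [Finset.HasAntidiagonal.mem_antidiagonal, ← hn]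
      exact F.degree_lea_add_degree_roo v
    · exact ⟨⟨_, ofForest_mem_grading K (F.lea v) (hF.restrict _)⟩ ⊗ₜ
        ⟨_, ofForest_mem_grading K (F.roo v) (hF.restrict _)⟩, rfl⟩
  counit_eq_zero n hn a ha := by
    have h : grading K n ≤ LinearMap.ker (maps K).counit := grading_le K fun F hF h =>
      counit_ofForest_of_degree_ne_zero K hF (h ▸ hn)
    exact h ha

theorem eq_counit_smul_one (a : Hhpo K) (ha : a ∈ grading K 0) :
    a = (maps K).counit a • (maps K).one := by
  suffices h : grading K 0 ≤ LinearMap.eqLocus LinearMap.id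
    ((maps K).counit.smulRight (maps K).one) from h ha
  refine grading_le K fun F hF h => ?_
  have hE : IsEmpty F.V := Finite.card_eq_zero_iff.1 h
  rw [LinearMap.mem_eqLocus, LinearMap.smulRight_apply]
  have h₁ : (maps K).counit (ofForest K F hF) = 1 := (Hpo.counit_basis K F).trans (if_pos hE)
  rw [h₁, one_smul]
  exact Subtype.ext (congrArg (Hpo.basis K) ((ForestClass.mk_eq_empty_iff F).2 hE))

/-- The restriction of `Phi` to `Hhpo K`. -/
noncomputable def toWQSym : Hhpo K →ₗ[K] WQSym K := Phi K ∘ₗ (Hhpo K).subtype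

theorem toWQSym_injective [CharZero K] : Function.Injective (toWQSym K) :=
  (injective_iff_map_eq_zero (toWQSym K)).2 fun x h =>
    Subtype.ext (eq_zero_of_Phi_eq_zero K x.2 h)

theorem toWQSym_mul (x y : Hhpo K) :
    toWQSym K ((maps K).mul x y) = (WQSym.maps K).mul (toWQSym K x) (toWQSym K y) :=
  Phi_mul K x y

theorem toWQSym_one : toWQSym K (maps K).one = (WQSym.maps K).one := Phi_one K

theorem toWQSym_comul (x : Hhpo K) :
    TensorProduct.map (toWQSym K) (toWQSym K) ((maps K).comul x)
      = (WQSym.maps K).comul (toWQSym K x) := by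
  refine Eq.trans ?_ (Phi_comul K x)
  rw [← tensorIncl_comul, toWQSym, TensorProduct.map_comp]
  rfl

theorem toWQSym_counit (x : Hhpo K) : (WQSym.maps K).counit (toWQSym K x) = (maps K).counit x :=
  Phi_counit K x

/-- Characteristic zero enters through injectivity of `toWQSym`; coassociativity of cuts is
inherited from deconcatenation. -/
theorem isHopf [CharZero K] : (maps K).IsHopf :=
  (WQSym.isHopf K).of_injective (toWQSym K) (toWQSym_injective K) (toWQSym_mul K) (toWQSym_one K)
    (toWQSym_comul K) (toWQSym_counit K) (isGraded K) (eq_counit_smul_one K)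

end Hhpo

theorem mainTheorem2 (K : Type*) [Field K] [CharZero K] :
    ∃ (hH : (Hhpo.maps K).IsHopf) (hW : (WQSym.maps K).IsHopf),
      (Hhpo.maps K).IsGraded (Hhpo.grading K) ∧
      (WQSym.maps K).IsGraded (WQSym.grading K) ∧
      letI := hH.ring
      letI := hH.hopfAlgebra
      letI := hW.ring
      letI := hW.hopfAlgebra
      ∃ f : Hhpo K →ₐc[K] WQSym K,
        (∀ x : Hhpo K, f x = Phi K x) ∧
        Function.Injective f ∧
        (∀ n, ∀ x ∈ Hhpo.grading K n, f x ∈ WQSym.grading K n) ∧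
        (∀ x : Hhpo K, f (HopfAlgebra.antipode K x) = HopfAlgebra.antipode K (f x)) := by
  refine ⟨Hhpo.isHopf K, WQSym.isHopf K, Hhpo.isGraded K, WQSym.isGraded K, ?_⟩
  let _ := (Hhpo.isHopf K).ring
  let _ := (Hhpo.isHopf K).hopfAlgebra
  let _ := (WQSym.isHopf K).ring
  let _ := (WQSym.isHopf K).hopfAlgebra
  let f : Hhpo K →ₐc[K] WQSym K :=
    { toFun := Hhpo.toWQSym K
      map_add' := map_add (Hhpo.toWQSym K)
      map_smul' := map_smul (Hhpo.toWQSym K)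
      counit_comp := LinearMap.ext (Hhpo.toWQSym_counit K)
      map_comp_comul := LinearMap.ext (Hhpo.toWQSym_comul K)
      map_one' := Hhpo.toWQSym_one K
      map_mul' := Hhpo.toWQSym_mul K }
  exact ⟨f, fun _ => rfl, Hhpo.toWQSym_injective K,
    fun n x hx => Phi_mem_grading K n x hx, BialgHom.map_antipode f⟩
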